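/- Let $\zeta$ be a primitive fifth root of unity, $F=\mathbb{Q}(\zeta)$ and $F_0=\mathbb{Q}(\zeta+\zeta^{-1})=\mathbb{Q}(\sqrt5)$, where $\sqrt5:=1+2(\zeta+\zeta^{-1})$. Write $u=(1+\sqrt5)/2$, let $\tau$ be the nontrivial automorphism of $F_0$, and $u^\tau=(1-\sqrt5)/2$. Put $\epsilon=\zeta+\zeta^{-1}$, $\alpha=\zeta-\zeta^{-1}$, $$\gamma_P=\begin{pmatrix}-\alpha&0\\0&\alpha\end{pmatrix},\qquad \gamma_Q=\begin{pmatrix}-\alpha/\epsilon&2\\2/\epsilon&\alpha/\epsilon\end{pmatrix},$$ and $$q_{Q,P}(x,y)=\det(x\gamma_Q+y\gamma_P)=3x^2+2\sqrt5\,u^2xy+\sqrt5\,u\,y^2 .$$ Let $\mathrm{GU}_2(\mathcal{O}_{F_0})$ be the set of matrices in $\mathrm{GL}_2(F)$ with entries in $\mathcal{O}_F$ that preserve, up to a scalar in $F_0^\times$, the Hermitian form on $F^2$ with Gram matrix $\mathrm{diag}(1,(1-\sqrt5)/2)$. An element $\lambda\in\mathcal{O}_{F_0}$ is *representable by $q_{Q,P}$*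 if $\lambda=q_{Q,P}(x,y)$ for some $x,y\in F_0$ with $x\gamma_Q+y\gamma_P\in\mathrm{GU}_2(\mathcal{O}_{F_0})$. Let $q^\tau_{Q,P}$ be the form whose coefficients are the $\tau$-conjugates of those of $q_{Q,P}$; representability by $q^\tau_{Q,P}$ is defined in the same way, with $\zeta$ replaced by $\zeta^2$ (hence $\sqrt5$ by $-\sqrt5$) in the matrices and in the Hermitian form. Let $\tilde L\supset F_0$ be the splitting field of $t^4-5$ over $\mathbb{Q}$. Let $\lambda$ be a totally positive irreducible element of $\mathcal{O}_{F_0}$. 1. Suppose that $\lambda$ is relatively prime to $2\sqrt5$. Then $\lambda$ is representable by both $q_{Q,P}$ and $q^\tau_{Q,P}$ if and only if the ideal $\langle\lambda\rangle$ of $\mathcal{O}_{F_0}$ splits completely in $\tilde L$ as a product of non-principal prime ideals. 2. Suppose that $\lambda\equiv-1 \bmod 4\mathcal{O}_{F_0}$ and that $\lambda$ is representable by both $q_{Q,P}$ and $q^\tau_{Q,P}$. Then there exist $x,y,x',y'\in F_0$ with $q_{Q,P}(x,y)=\lambda$ and $q^\tau_{Q,P}(x',y')=\lambda$ such that $x_1=2x$,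 $d_1=y+ux$, $x_1'=2x'$, $d_1'=y'+u^\tau x'$ all lie in $\mathcal{O}_{F_0}$, and $(x_1,d_1)\equiv(0,u)$ and $(x_1',d_1')\equiv(0,u^\tau) \bmod 2\mathcal{O}_{F_0}$. -/

import Mathlib

open NumberField

noncomputable section

open IntermediateField Matrix

namespace QuadRep

/-- The cyclotomic field `F = ℚ(ζ₅)`. -/
abbrev F : Type := CyclotomicField 5 ℚ

instance : IsCyclotomicExtension {5} ℚ F :=
  haveI : NeZero ((5 : ℕ) : ℚ) := ⟨by norm_num⟩
  CyclotomicField.isCyclotomicExtension 5 ℚ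

/-- The primitive fifth root of unity `ζ`. -/
def zeta : F := IsCyclotomicExtension.zeta 5 ℚ F

lemma zeta_spec : IsPrimitiveRoot zeta 5 := IsCyclotomicExtension.zeta_spec 5 ℚ F

instance : IsCMField F :=
  IsCyclotomicExtension.Rat.isCMField F (S := {5}) ⟨5, rfl, by norm_num⟩

/-- The quadratic field `F₀ = ℚ(ζ + ζ⁻¹)`, that is `ℚ(√5)`. -/
abbrev F₀ : Type := ℚ⟮zeta + zeta⁻¹⟯

/-- The generator `ζ + ζ⁻¹ = (-1 + √5)/2` of `F₀`. -/
def eps₀ : F₀ := AdjoinSimple.gen ℚ (zeta + zeta⁻¹)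

/-- The square root of `5` in `F₀`. -/
def sqrt5 : F₀ := 2 * eps₀ + 1

/-- The fundamental unit `(1 + √5)/2`, as an element of `F₀`. -/
def u : F₀ := (1 + sqrt5) / 2

/-- Its conjugate `(1 - √5)/2`. -/
def uConj : F₀ := (1 - sqrt5) / 2

lemma coe_eps₀ : (eps₀ : F) = zeta + zeta⁻¹ := AdjoinSimple.coe_gen ℚ _

lemma zeta_ne_zero : zeta ≠ 0 := zeta_spec.ne_zero (by norm_num)

lemma zeta_cyclo : zeta ^ 4 + zeta ^ 3 + zeta ^ 2 + zeta + 1 = 0 := by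
  have h := zeta_spec.geom_sum_eq_zero (by norm_num)
  simp only [Finset.sum_range_succ, Finset.sum_range_zero] at h
  linear_combination h

lemma zeta_pow_five : zeta ^ 5 = 1 := zeta_spec.pow_eq_one

lemma zeta_inv : zeta⁻¹ = zeta ^ 4 :=
  inv_eq_of_mul_eq_one_right (by rw [← zeta_pow_five]; ring)

lemma eps₀_sq : eps₀ ^ 2 + eps₀ - 1 = 0 := by
  apply Subtype.ext
  push_cast
  rw [coe_eps₀, zeta_inv]
  linear_combination zeta_cyclo + (zeta ^ 3 + 2) * zeta_pow_five

lemma sqrt5_sq : sqrt5 ^ 2 = 5 := by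
  unfold sqrt5; linear_combination 4 * eps₀_sq

lemma u_isIntegral : IsIntegral ℤ u := by
  refine ⟨Polynomial.X ^ 2 - Polynomial.X - 1, by monicity!, ?_⟩
  simp only [Polynomial.eval₂_sub, Polynomial.eval₂_pow, Polynomial.eval₂_X, Polynomial.eval₂_one]
  unfold u; linear_combination (1 / 4 : F₀) * sqrt5_sq

/-- `(1 + √5)/2` as an element of the ring of integers. -/
def uInt : 𝓞 F₀ := ⟨u, u_isIntegral⟩

/-- `(1 - √5)/2` as an element of the ring of integers. -/
def uConjInt : 𝓞 F₀ := 1 - uInt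

/-- `√5` as an element of the ring of integers. -/
def sqrt5Int : 𝓞 F₀ := 2 * uInt - 1

lemma coe_uInt : (uInt : F₀) = u := rfl

lemma coe_uConjInt : (uConjInt : F₀) = uConj := by
  simp only [uConjInt, map_sub, map_one, coe_uInt, u, uConj]; ring

lemma coe_sqrt5Int : (sqrt5Int : F₀) = sqrt5 := by
  simp only [sqrt5Int, map_sub, map_mul, map_ofNat, map_one, coe_uInt, u]; ring

/-! The binary quadratic form `q` and its conjugate. -/

/-- The form `q(x, y) = 3 x² + 2 √5 u² x y + √5 u y²`. -/
def q (x y : F₀) : F₀ := 3 * x ^ 2 + 2 * sqrt5 * u ^ 2 * x * y + sqrt5 * u * y ^ 2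

/-- The form whose coefficients are the conjugates of those of `q`. -/
def qConj (x y : F₀) : F₀ :=
  3 * x ^ 2 + 2 * (-sqrt5) * uConj ^ 2 * x * y + (-sqrt5) * uConj * y ^ 2

/-! Matrices attached to a primitive fifth root of unity `z`. The choice `z = ζ` gives the form `q`;
`z = ζ²`, the image of `ζ` under an automorphism of `F` that restricts to the nontrivial
automorphism of `F₀`, gives the conjugate of all the data. -/

/-- `α = z - z⁻¹`. -/
def alpha (z : F) : F := z - z⁻¹

/-- `ε = z + z⁻¹`. -/
def eps (z : F) : F := z + z⁻¹

/-- The trace zero matrix `γ_P`. -/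
def gammaP (z : F) : Matrix (Fin 2) (Fin 2) F := !![-alpha z, 0; 0, alpha z]

/-- The trace zero matrix `γ_Q`. -/
def gammaQ (z : F) : Matrix (Fin 2) (Fin 2) F :=
  !![-(alpha z / eps z), 2; 2 / eps z, alpha z / eps z]

/-- The Gram matrix of the Hermitian form on `F²`. Here `-ε = (1 - √5)/2` for `z = ζ`. -/
def hermGram (z : F) : Matrix (Fin 2) (Fin 2) F := !![1, 0; 0, -eps z]

/-- The conjugate transpose with respect to the complex conjugation of the CM field `F`. -/
def conjTr (M : Matrix (Fin 2) (Fin 2) F) : Matrix (Fin 2) (Fin 2) F :=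
  Mᵀ.map (IsCMField.complexConj F)

/-- The invertible matrices over `F` that preserve the Hermitian form up to a scalar in `F₀ˣ`
and have entries in the ring of integers of `F`. -/
def GU₂ (z : F) : Set (Matrix (Fin 2) (Fin 2) F) :=
  {M | M.det ≠ 0 ∧ (∃ c : F₀, c ≠ 0 ∧ conjTr M * hermGram z * M = (c : F) • hermGram z) ∧
    ∀ i j, IsIntegral ℤ (M i j)}

/-- `lam` is represented by `q`. -/
def Representable (lam : 𝓞 F₀) : Prop :=
  ∃ x y : F₀, q x y = lam ∧ (x : F) • gammaQ zeta + (y : F) • gammaP zeta ∈ GU₂ zeta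

/-- `lam` is represented by the conjugate form. -/
def RepresentableConj (lam : 𝓞 F₀) : Prop :=
  ∃ x y : F₀, qConj x y = lam ∧
    (x : F) • gammaQ (zeta ^ 2) + (y : F) • gammaP (zeta ^ 2) ∈ GU₂ (zeta ^ 2)

lemma coe_two : ((2 : F₀) : F) = 2 := rfl

lemma coe_three : ((3 : F₀) : F) = 3 := rfl

lemma coe_sqrt5 : (sqrt5 : F) = 2 * zeta + 2 * zeta ^ 4 + 1 := by
  have h : (sqrt5 : F) = 2 * (eps₀ : F) + 1 := rfl
  linear_combination h + 2 * coe_eps₀ + 2 * zeta_inv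

lemma coe_sqrt5_sq : (sqrt5 : F) ^ 2 = 5 := congrArg (algebraMap F₀ F) sqrt5_sq

lemma zeta_sq_inv : (zeta ^ 2)⁻¹ = zeta ^ 3 :=
  inv_eq_of_mul_eq_one_right (by rw [← zeta_pow_five]; ring)

lemma eps_zeta : eps zeta = zeta + zeta ^ 4 := by rw [eps, zeta_inv]

lemma alpha_zeta : alpha zeta = zeta - zeta ^ 4 := by rw [alpha, zeta_inv]

lemma eps_inv : (eps zeta)⁻¹ = (1 + (sqrt5 : F)) / 2 := by
  refine inv_eq_of_mul_eq_one_right ?_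
  rw [eps_zeta, coe_sqrt5]
  linear_combination zeta_cyclo + (zeta ^ 3 + 2) * zeta_pow_five

lemma eps_sq_inv : (eps (zeta ^ 2))⁻¹ = (1 - (sqrt5 : F)) / 2 := by
  refine inv_eq_of_mul_eq_one_right ?_
  rw [eps, zeta_sq_inv, coe_sqrt5]
  linear_combination - zeta_cyclo - (zeta ^ 2 + zeta) * zeta_pow_five

lemma alpha_sq : alpha zeta ^ 2 = -((sqrt5 : F) * (1 + (sqrt5 : F)) / 2) := by
  rw [alpha_zeta]
  linear_combination (1 / 2 : F) * coe_sqrt5_sq + (1 / 2 : F) * coe_sqrt5 + zeta_cyclo +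
    (zeta ^ 3 - 2) * zeta_pow_five

lemma alpha_sq_sq : alpha (zeta ^ 2) ^ 2 = (sqrt5 : F) * (1 - (sqrt5 : F)) / 2 := by
  rw [alpha, zeta_sq_inv]
  linear_combination (1 / 2 : F) * coe_sqrt5_sq - (1 / 2 : F) * coe_sqrt5 +
    (zeta - 2) * zeta_pow_five

/-- `q(x, y)` is the determinant of `x γ_Q + y γ_P`. -/
lemma det_eq_q (x y : F₀) :
    ((x : F) • gammaQ zeta + (y : F) • gammaP zeta).det = (q x y : F₀) := by
  have h5 := coe_sqrt5_sq
  have ha := alpha_sq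
  have he := eps_inv
  simp only [gammaQ, gammaP, q, u, div_eq_mul_inv _ (eps _), he, det_fin_two, Matrix.add_apply,
    Matrix.smul_apply, smul_eq_mul, of_apply, cons_val', cons_val_zero, cons_val_one,
    cons_val_fin_one]
  push_cast [coe_two, coe_three]
  set s : F := (sqrt5 : F)
  linear_combination (-((x : F) * ((1 + s) / 2) + y) ^ 2) * ha +
    (s ^ 2 / 8 + 3 * s / 8 + 1) * (x : F) ^ 2 * h5

/-- The same for the conjugate form. -/
lemma det_eq_qConj (x y : F₀) :
    ((x : F) • gammaQ (zeta ^ 2) + (y : F) • gammaP (zeta ^ 2)).det = (qConj x y : F₀) := by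
  have h5 := coe_sqrt5_sq
  have ha := alpha_sq_sq
  have he := eps_sq_inv
  simp only [gammaQ, gammaP, qConj, uConj, div_eq_mul_inv _ (eps _), he, det_fin_two,
    Matrix.add_apply, Matrix.smul_apply, smul_eq_mul, of_apply, cons_val', cons_val_zero,
    cons_val_one, cons_val_fin_one]
  push_cast [coe_two, coe_three]
  set s : F := (sqrt5 : F)
  linear_combination (-((x : F) * ((1 - s) / 2) + y) ^ 2) * ha +
    (s ^ 2 / 8 - 3 * s / 8 + 1) * (x : F) ^ 2 * h5

/-- Positive under every embedding into `ℝ`. -/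
def TotallyPositive (lam : 𝓞 F₀) : Prop := ∀ φ : F₀ →+* ℝ, 0 < φ lam

/-- Every prime of `L` above `I` is unramified of residue degree one over `F₀`. -/
def SplitsCompletely (L : Type*) [Field L] [Algebra F₀ L] (I : Ideal (𝓞 F₀)) : Prop :=
  ∀ P ∈ I.primesOver (𝓞 L), P.ramificationIdx (𝓞 F₀) = 1 ∧ P.inertiaDeg (𝓞 F₀) = 1

/-- The ideal `I` splits completely in `L` and none of the primes above it is principal. -/
def SplitsNonPrincipal (L : Type*) [Field L] [Algebra F₀ L] (I : Ideal (𝓞 F₀)) : Prop :=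
  SplitsCompletely L I ∧ ∀ P ∈ I.primesOver (𝓞 L), ¬ P.IsPrincipal

end QuadRep

end

/-!
Membership of `xγ_Q + yγ_P` in `GU₂` amounts to the integrality of `a = 2x` and `b = y + ux`, and
`q(x, y) = u(√5b² - a²)`. So `λ` is representable if and only if `λ = u(√5b² - a²)` with `a` and `b`
integral; for `λ ≡ -1 mod 4` the congruences on `a` and `b` can then be reached by multiplying
`a + b√√5` by a unit of relative norm one.

Over `F₀` the splitting field of `t⁴ - 5` is the biquadratic field `L = F₀(√-1, √√5)`. If `λ` is
represented by both forms, then `√5` and `-√5` are squares modulo `λ`, hence so is `-1`, and `λ`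
splits completely. A generator of a prime above `λ` would have relative norm `λη²` for a unit `η`,
because norms from `L` are totally positive and totally positive units are squares; since norms from
`F₀(√√5)` are squares modulo `√5`, so would be `λ`. But `-u` is not a square modulo `√5`.

Conversely, if `√5` is a square modulo `λ`, then `λ` is up to a unit a norm from `𝓞[√√5]`, and
considering signs either `λ` is representable or `λ = c² - √5e²`. As `-1` is a square modulo `λ`,
also `λ = x² + y²`. These two equations together make `λ` the relative norm, up to powers of `2`, of
a sum of two squares `j² + k²` in `𝓞[√-√5]`, whence `λ` is up to a unit the norm of an integer of
`L`, which then generates a prime above `λ`.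
-/

noncomputable section

namespace QuadRep

open Real (goldenRatio goldenConj)
open scoped Pointwise

/-! ### The golden ring -/

/-- The ring `ℤ[w]` with `w² = w + 1`, up to isomorphism the ring of integers of `ℚ(√5)`. The data
consist of a choice of `w` among the two roots and of the corresponding ordering of the two real
embeddings: `φ` maps `w` to the golden ratio. -/
structure GoldenData (O : Type*) [CommRing O] where
  /-- the generator -/
  w : O
  w_sq : w ^ 2 = w + 1
  span : ∀ x : O, ∃ m n : ℤ, x = m + n * w
  /-- the embedding with `w ↦ (1 + √5) / 2` -/
  φ : O →+* ℝ
  /-- the embedding with `w ↦ (1 - √5) / 2` -/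
  ψ : O →+* ℝ
  φ_w : φ w = goldenRatio
  ψ_w : ψ w = goldenConj

namespace GoldenData

variable {O : Type*} [CommRing O] (d : GoldenData O)

/-- The same ring with the conjugate generator. -/
def conj : GoldenData O where
  w := 1 - d.w
  w_sq := by linear_combination d.w_sq
  span x := by
    obtain ⟨m, n, rfl⟩ := d.span x
    exact ⟨m + n, -n, by push_cast; ring⟩
  φ := d.ψ
  ψ := d.φ
  φ_w := by rw [map_sub, map_one, d.ψ_w, Real.one_sub_goldenRatio]
  ψ_w := by rw [map_sub, map_one, d.φ_w, Real.one_sub_goldenConj]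

/-- The square root `2 w - 1` of `5`. -/
def sqrtFive : O := 2 * d.w - 1

lemma sqrtFive_sq : d.sqrtFive ^ 2 = 5 := by
  unfold sqrtFive; linear_combination 4 * d.w_sq

lemma conj_sqrtFive : d.conj.sqrtFive = -d.sqrtFive := by simp only [sqrtFive, conj]; ring

lemma φ_sqrtFive : d.φ d.sqrtFive = √5 := by
  simp only [sqrtFive, map_sub, map_mul, map_ofNat, map_one, d.φ_w, goldenRatio]; ring

lemma ψ_sqrtFive : d.ψ d.sqrtFive = -√5 := by
  simp only [sqrtFive, map_sub, map_mul, map_ofNat, map_one, d.ψ_w, goldenConj]; ring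

lemma φ_injective : Function.Injective d.φ := by
  rw [injective_iff_map_eq_zero]
  intro x hx
  obtain ⟨m, n, rfl⟩ := d.span x
  simp only [map_add, map_intCast, map_mul, d.φ_w] at hx
  have hn : n = 0 := by
    by_contra hn
    have hirr := (Real.goldenRatio_irrational.intCast_mul hn).intCast_add m
    exact not_irrational_zero (hx ▸ hirr)
  subst hn
  simp only [Int.cast_zero, zero_mul, add_zero, Int.cast_eq_zero] at hx
  simp [hx]

lemma ψ_injective : Function.Injective d.ψ := d.conj.φ_injective

include d in
lemma isDomain : IsDomain O := d.φ_injective.isDomain d.φ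

include d in
lemma charZero : CharZero O := d.φ.charZero

/-- The norm to `ℤ`; the number being rounded is already an integer. -/
def norm (x : O) : ℤ := round (d.φ x * d.ψ x)

lemma φ_mul_ψ (m n : ℤ) : d.φ (m + n * d.w) * d.ψ (m + n * d.w) =
    ((m ^ 2 + m * n - n ^ 2 : ℤ) : ℝ) := by
  simp only [map_add, map_intCast, map_mul, d.φ_w, d.ψ_w]
  push_cast
  linear_combination (m * n : ℝ) * Real.goldenRatio_add_goldenConj +
    (n ^ 2 : ℝ) * Real.goldenRatio_mul_goldenConj

lemma norm_add_mul_w (m n : ℤ) : d.norm (m + n * d.w) = m ^ 2 + m * n - n ^ 2 := by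
  rw [norm, φ_mul_ψ, round_intCast]

lemma coe_norm (x : O) : (d.norm x : ℝ) = d.φ x * d.ψ x := by
  obtain ⟨m, n, rfl⟩ := d.span x
  rw [norm_add_mul_w, φ_mul_ψ]

lemma norm_mul (x y : O) : d.norm (x * y) = d.norm x * d.norm y := by
  have h : (d.norm (x * y) : ℝ) = d.norm x * d.norm y := by
    simp only [coe_norm, map_mul]; ring
  exact_mod_cast h

lemma norm_intCast (m : ℤ) : d.norm m = m ^ 2 := by simpa using d.norm_add_mul_w m 0

lemma norm_eq_zero {x : O} : d.norm x = 0 ↔ x = 0 := by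
  rw [← Int.cast_eq_zero (α := ℝ), coe_norm, mul_eq_zero, map_eq_zero_iff _ d.φ_injective,
    map_eq_zero_iff _ d.ψ_injective, or_self]

lemma norm_dvd_norm {x y : O} (h : x ∣ y) : d.norm x ∣ d.norm y := by
  obtain ⟨z, rfl⟩ := h
  exact ⟨_, d.norm_mul _ _⟩

lemma exists_mul_eq_norm (x : O) : ∃ y, x * y = d.norm x := by
  obtain ⟨m, n, rfl⟩ := d.span x
  refine ⟨m + n * (1 - d.w), ?_⟩
  rw [norm_add_mul_w]
  push_cast
  linear_combination (-n ^ 2 : O) * d.w_sq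

lemma isUnit_iff {x : O} : IsUnit x ↔ (d.norm x).natAbs = 1 := by
  refine ⟨fun h ↦ ?_, fun h ↦ ?_⟩
  · have hdvd := d.norm_dvd_norm h.dvd (y := 1)
    rw [show d.norm 1 = 1 by simpa using d.norm_intCast 1] at hdvd
    exact Int.isUnit_iff_natAbs_eq.1 (isUnit_of_dvd_one hdvd)
  · obtain ⟨y, hy⟩ := d.exists_mul_eq_norm x
    refine isUnit_of_mul_isUnit_left (y := y) ?_
    rw [hy]
    exact (Int.isUnit_iff_natAbs_eq.2 h).map (Int.castRingHom O)

lemma norm_w : d.norm d.w = -1 := by simpa using d.norm_add_mul_w 0 1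

lemma norm_sqrtFive : d.norm d.sqrtFive = -5 := by
  have h := d.norm_add_mul_w (-1) 2
  rw [show ((-1 : ℤ) : O) + (2 : ℤ) * d.w = d.sqrtFive by rw [sqrtFive]; push_cast; ring] at h
  exact h

lemma isUnit_w : IsUnit d.w := d.isUnit_iff.2 (by rw [norm_w]; rfl)

/-! ### Primes of the golden ring -/

lemma natCast_dvd_of_dvd_norm {p : ℕ}
    (hp : ∀ a b : ZMod p, a ^ 2 + a * b - b ^ 2 = 0 → a = 0 ∧ b = 0) {x : O}
    (h : (p : ℤ) ∣ d.norm x) : (p : O) ∣ x := by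
  obtain ⟨m, n, rfl⟩ := d.span x
  rw [norm_add_mul_w, ← ZMod.intCast_zmod_eq_zero_iff_dvd] at h
  push_cast at h
  obtain ⟨hm, hn⟩ := hp m n h
  rw [ZMod.intCast_zmod_eq_zero_iff_dvd] at hm hn
  have hcast {k : ℤ} (hk : (p : ℤ) ∣ k) : (p : O) ∣ k := by
    simpa using map_dvd (Int.castRingHom O) hk
  exact dvd_add (hcast hm) ((hcast hn).mul_right _)

lemma two_dvd_of_two_dvd_norm {x : O} (h : 2 ∣ d.norm x) : 2 ∣ x := by
  exact_mod_cast d.natCast_dvd_of_dvd_norm (p := 2) (by decide) (by exact_mod_cast h)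

/-- The hypothesis `hp` makes `p` inert, and an inert prime divides a norm to an even power. -/
lemma norm_natAbs_ne {p : ℕ} (hp1 : 1 < p)
    (hp : ∀ a b : ZMod p, a ^ 2 + a * b - b ^ 2 = 0 → a = 0 ∧ b = 0) (x : O) :
    (d.norm x).natAbs ≠ p := by
  intro h
  have hdvd : (p : ℤ) ∣ d.norm x := by rw [← Int.natAbs_dvd_natAbs, h, Int.natAbs_natCast]
  have h2 := d.norm_dvd_norm (d.natCast_dvd_of_dvd_norm hp hdvd)
  rw [show d.norm (p : O) = (p : ℤ) ^ 2 by simpa using d.norm_intCast p,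
    ← Int.natAbs_dvd_natAbs, h, Int.natAbs_pow, Int.natAbs_natCast] at h2
  nlinarith [Nat.le_of_dvd (by omega) h2]

lemma prime_of_dvd_norm {p : ℤ} (hp : Prime p) {π : O} (h0 : π ≠ 0) (hπ : p ∣ d.norm π)
    (h : ∀ x, p ∣ d.norm x → π ∣ x) : Prime π := by
  refine ⟨h0, fun hu ↦ hp.not_isUnit ?_, fun a b hab ↦ ?_⟩
  · exact isUnit_of_dvd_unit hπ (Int.isUnit_iff_natAbs_eq.2 (d.isUnit_iff.1 hu))
  · have hdvd := hπ.trans (d.norm_dvd_norm hab)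
    rw [norm_mul] at hdvd
    exact (hp.dvd_or_dvd hdvd).imp (h a) (h b)

include d in
lemma prime_two : Prime (2 : O) := by
  have := d.charZero
  have hnorm : d.norm 2 = 4 := by simpa using d.norm_intCast 2
  exact d.prime_of_dvd_norm Int.prime_two two_ne_zero (by rw [hnorm]; norm_num)
    fun x ↦ d.two_dvd_of_two_dvd_norm

lemma sqrtFive_dvd_add_mul_w_sub (m n : ℤ) :
    d.sqrtFive ∣ (m + n * d.w) - ((m + 3 * n : ℤ) : O) := by
  refine ⟨n * (1 - d.w), ?_⟩
  unfold sqrtFive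
  push_cast
  linear_combination (2 * n : O) * d.w_sq

lemma exists_sqrtFive_dvd_sub_intCast (x : O) : ∃ k : ℤ, d.sqrtFive ∣ x - k := by
  obtain ⟨m, n, rfl⟩ := d.span x
  exact ⟨_, d.sqrtFive_dvd_add_mul_w_sub m n⟩

lemma sqrtFive_dvd_intCast {k : ℤ} : d.sqrtFive ∣ (k : O) ↔ 5 ∣ k := by
  constructor
  · intro h
    have hdvd := d.norm_dvd_norm h
    rw [norm_sqrtFive, norm_intCast, neg_dvd] at hdvd
    exact (by norm_num : Prime (5 : ℤ)).dvd_of_dvd_pow hdvd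
  · rintro ⟨l, rfl⟩
    exact ⟨d.sqrtFive * l, by push_cast; linear_combination (-l : O) * d.sqrtFive_sq⟩

lemma sqrtFive_dvd_of_five_dvd_norm {x : O} (h : 5 ∣ d.norm x) : d.sqrtFive ∣ x := by
  obtain ⟨m, n, rfl⟩ := d.span x
  rw [norm_add_mul_w] at h
  have hsq : 5 ∣ (m + 3 * n) ^ 2 := by
    rw [show (m + 3 * n) ^ 2 = m ^ 2 + m * n - n ^ 2 + 5 * (m * n + 2 * n ^ 2) by ring]
    exact h.add (dvd_mul_right _ _)
  have hdvd := (by norm_num : Prime (5 : ℤ)).dvd_of_dvd_pow hsq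
  exact (dvd_sub_left (d.sqrtFive_dvd_intCast.2 hdvd)).1 (d.sqrtFive_dvd_add_mul_w_sub m n)

lemma prime_sqrtFive : Prime d.sqrtFive := by
  refine d.prime_of_dvd_norm (p := 5) (by norm_num) ?_ (by rw [norm_sqrtFive]; norm_num)
    fun x ↦ d.sqrtFive_dvd_of_five_dvd_norm
  rw [Ne, ← norm_eq_zero, norm_sqrtFive]
  norm_num

/-- `2` is not a square modulo `√5`. -/
lemma sqrtFive_dvd_of_sq_sub_two_mul_sq {x y : O} (h : d.sqrtFive ∣ x ^ 2 - 2 * y ^ 2) :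
    d.sqrtFive ∣ y := by
  obtain ⟨k, hk⟩ := d.exists_sqrtFive_dvd_sub_intCast x
  obtain ⟨l, hl⟩ := d.exists_sqrtFive_dvd_sub_intCast y
  have hint : d.sqrtFive ∣ ((k ^ 2 - 2 * l ^ 2 : ℤ) : O) := by
    have hsplit : ((k ^ 2 - 2 * l ^ 2 : ℤ) : O) = x ^ 2 - 2 * y ^ 2 - (x - k) * (x + k)
      + (y - l) * (2 * (y + l)) := by push_cast; ring
    rw [hsplit]
    exact dvd_add (dvd_sub h (hk.mul_right _)) (hl.mul_right _)
  rw [sqrtFive_dvd_intCast] at hint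
  replace hint := (ZMod.intCast_zmod_eq_zero_iff_dvd _ 5).2 hint
  push_cast at hint
  have hanis : ∀ a b : ZMod 5, a ^ 2 - 2 * b ^ 2 = 0 → b = 0 := by decide
  refine (dvd_sub_left (d.sqrtFive_dvd_intCast.2 ?_)).1 hl
  exact (ZMod.intCast_zmod_eq_zero_iff_dvd l 5).1 (hanis _ _ hint)

end GoldenData

lemma goldenRatio_lt : goldenRatio < 1.62 := by
  nlinarith [Real.goldenRatio_pos, Real.goldenRatio_sq]

namespace GoldenData

variable {O : Type*} [CommRing O] (d : GoldenData O)

/-! ### Units of the golden ring -/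

/-- The unit `w`. -/
def wUnit : Oˣ := d.isUnit_w.unit

lemma map_wUnit_zpow (f : O →+* ℝ) (k : ℤ) : f (d.wUnit ^ k : Oˣ) = f d.w ^ k := by
  have h := congrArg Units.val (map_zpow (Units.map (f : O →* ℝ)) d.wUnit k)
  rwa [Units.val_zpow_eq_zpow_val] at h

/-- Multiplying by a power of `w` makes the two real absolute values comparable. -/
lemma exists_zpow_balanced (x : O) : ∃ k : ℤ,
    d.φ (x * (d.wUnit ^ k : Oˣ)) ^ 2 ≤ goldenRatio * |(d.norm x : ℝ)| ∧
    d.ψ (x * (d.wUnit ^ k : Oˣ)) ^ 2 ≤ goldenRatio * |(d.norm x : ℝ)| := by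
  rcases eq_or_ne x 0 with rfl | hx
  · exact ⟨0, by simp [norm]⟩
  set g := goldenRatio
  have g1 : 1 < g := Real.one_lt_goldenRatio
  have ha : 0 < |d.φ x| := abs_pos.2 ((map_ne_zero_iff _ d.φ_injective).2 hx)
  have hb : 0 < |d.ψ x| := abs_pos.2 ((map_ne_zero_iff _ d.ψ_injective).2 hx)
  obtain ⟨n, hn1, hn2⟩ := exists_mem_Ico_zpow (x := |d.φ x| / |d.ψ x| * g) (y := g ^ 2)
    (by positivity) (by nlinarith)
  have hgn : 0 < g ^ n := by positivity
  have hsq : (g ^ 2) ^ n = (g ^ n) ^ 2 := by rw [← zpow_natCast, zpow_comm, zpow_natCast]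
  rw [zpow_add₀ (by positivity), zpow_one] at hn2
  rw [hsq, div_mul_eq_mul_div] at hn1 hn2
  rw [le_div_iff₀ hb] at hn1
  rw [div_lt_iff₀ hb] at hn2
  have hconj : |goldenConj| = g⁻¹ := by rw [Real.inv_goldenRatio, abs_of_neg Real.goldenConj_neg]
  refine ⟨-n, ?_, ?_⟩
  · rw [map_mul, map_wUnit_zpow, φ_w, coe_norm, ← sq_abs, abs_mul, abs_zpow,
      abs_of_pos Real.goldenRatio_pos, abs_mul, zpow_neg, ← div_eq_mul_inv, div_pow,
      div_le_iff₀ (by positivity)]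
    nlinarith
  · rw [map_mul, map_wUnit_zpow, ψ_w, coe_norm, ← sq_abs, abs_mul, abs_zpow, hconj,
      abs_mul, inv_zpow', neg_neg]
    nlinarith

lemma exists_trace_int (x : O) : ∃ k : ℤ, d.φ x + d.ψ x = k := by
  obtain ⟨m, n, rfl⟩ := d.span x
  refine ⟨2 * m + n, ?_⟩
  simp only [map_add, map_intCast, map_mul, d.φ_w, d.ψ_w]
  push_cast
  linear_combination (n : ℝ) * Real.goldenRatio_add_goldenConj

/-- The trace of the totally positive unit `e²` is an integer between `2` and `g + g⁻¹ < 3`. -/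
lemma sq_eq_one_of_balanced {e : O} (he : IsUnit e) (h1 : d.φ e ^ 2 ≤ goldenRatio)
    (h2 : d.ψ e ^ 2 ≤ goldenRatio) : e ^ 2 = 1 := by
  have hN : d.φ e ^ 2 * d.ψ e ^ 2 = 1 := by
    rw [← mul_pow, ← coe_norm, ← sq_abs, ← Int.cast_abs, ← Nat.cast_natAbs, d.isUnit_iff.1 he]
    simp
  obtain ⟨k, hk⟩ := d.exists_trace_int (e ^ 2)
  rw [map_pow, map_pow] at hk
  have hk_lt : (k : ℝ) < 3 := by
    have hconvex := mul_nonneg (sub_nonneg.2 h1) (sub_nonneg.2 h2)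
    nlinarith [Real.one_lt_goldenRatio, Real.goldenRatio_sq]
  have hk_gt : (1 : ℝ) < k := by
    nlinarith [sq_nonneg (d.φ e ^ 2 - d.ψ e ^ 2), sq_nonneg (d.φ e), sq_nonneg (d.ψ e)]
  obtain rfl : k = 2 := by
    have hlt : k < 3 := by exact_mod_cast hk_lt
    have hgt : 1 < k := by exact_mod_cast hk_gt
    omega
  have hsq : (d.φ e ^ 2 - 1) ^ 2 = 0 := by push_cast at hk; linear_combination d.φ e ^ 2 * hk - hN
  refine d.φ_injective ?_
  rw [map_pow, map_one]
  linarith [pow_eq_zero_iff two_ne_zero |>.1 hsq]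

lemma exists_eq_zpow_or_eq_neg_zpow {ε : O} (hε : IsUnit ε) :
    ∃ n : ℤ, ε = (d.wUnit ^ n : Oˣ) ∨ ε = -(d.wUnit ^ n : Oˣ) := by
  have := d.isDomain
  obtain ⟨k, h1, h2⟩ := d.exists_zpow_balanced ε
  have hN : |(d.norm ε : ℝ)| = 1 := by
    rw [← Int.cast_abs, ← Nat.cast_natAbs, d.isUnit_iff.1 hε, Nat.cast_one]
  rw [hN, mul_one] at h1 h2
  have hsq := d.sq_eq_one_of_balanced (hε.mul (Units.isUnit _)) h1 h2
  have hcancel : ε = ε * (d.wUnit ^ k : Oˣ) * (d.wUnit ^ (-k) : Oˣ) := by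
    rw [mul_assoc, ← Units.val_mul, ← zpow_add, add_neg_cancel, zpow_zero, Units.val_one, mul_one]
  refine ⟨-k, (sq_eq_one_iff.1 hsq).imp (fun h ↦ ?_) fun h ↦ ?_⟩
  · rw [hcancel, h, one_mul]
  · rw [hcancel, h, neg_one_mul]

lemma unit_eq_sq_or_neg_w_mul_sq {ε : O} (hε : IsUnit ε) (h : 0 < d.ψ ε) :
    (∃ η : O, IsUnit η ∧ ε = η ^ 2) ∨ ∃ η : O, IsUnit η ∧ ε = -(d.w * η ^ 2) := by
  have hw : d.ψ d.w < 0 := by rw [ψ_w]; exact Real.goldenConj_neg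
  obtain ⟨n, hn⟩ := d.exists_eq_zpow_or_eq_neg_zpow hε
  rcases Int.even_or_odd' n with ⟨m, rfl | rfl⟩
  · have hpos : 0 < d.ψ (d.wUnit ^ (2 * m) : Oˣ) := by
      rw [map_wUnit_zpow]; exact (even_two_mul m).zpow_pos hw.ne
    refine .inl ⟨(d.wUnit ^ m : Oˣ), Units.isUnit _, ?_⟩
    rcases hn with rfl | rfl
    · rw [two_mul, zpow_add, Units.val_mul, sq]
    · rw [map_neg] at h; linarith
  · have hneg : d.ψ (d.wUnit ^ (2 * m + 1) : Oˣ) < 0 := by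
      rw [map_wUnit_zpow]; exact (odd_two_mul_add_one m).zpow_neg hw
    refine .inr ⟨(d.wUnit ^ m : Oˣ), Units.isUnit _, ?_⟩
    rcases hn with rfl | rfl
    · linarith
    · rw [zpow_add, two_mul, zpow_add, zpow_one, Units.val_mul, Units.val_mul, sq, mul_comm]
      rfl

lemma unit_eq_sq {ε : O} (hε : IsUnit ε) (h1 : 0 < d.φ ε) (h2 : 0 < d.ψ ε) :
    ∃ η : O, IsUnit η ∧ ε = η ^ 2 := by
  refine (d.unit_eq_sq_or_neg_w_mul_sq hε h2).resolve_right ?_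
  rintro ⟨η, -, rfl⟩
  rw [map_neg, map_mul, map_pow, φ_w] at h1
  nlinarith [mul_nonneg Real.goldenRatio_pos.le (sq_nonneg (d.φ η))]

/-! ### Reduction of binary quadratic forms -/

lemma exists_near (x y : ℝ) : ∃ t : O, |(x - d.φ t) * (y - d.ψ t)| ≤ 5 / 16 ∧
    (x - d.φ t) ^ 2 + (y - d.ψ t) ^ 2 ≤ 9 / 8 := by
  have h5 : (√5 : ℝ) ^ 2 = 5 := Real.sq_sqrt (by norm_num)
  obtain ⟨n, s, hs, hxy⟩ : ∃ (n : ℤ) (s : ℝ), |s| ≤ 1 / 2 ∧ x - y = √5 * (s + n) := by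
    refine ⟨round ((x - y) / √5), (x - y) / √5 - round ((x - y) / √5), abs_sub_round _, ?_⟩
    field_simp
    ring
  obtain ⟨m, v, hv, hmv⟩ : ∃ (m : ℤ) (v : ℝ), |v| ≤ 1 / 2 ∧ (x + y) / 2 - n / 2 = v + m :=
    ⟨round ((x + y) / 2 - n / 2), _, abs_sub_round _, (sub_add_cancel _ _).symm⟩
  have hx : x - d.φ (m + n * d.w) = v + s * √5 / 2 := by
    simp only [map_add, map_intCast, map_mul, d.φ_w, goldenRatio]
    linear_combination hxy / 2 + hmv
  have hy : y - d.ψ (m + n * d.w) = v - s * √5 / 2 := by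
    simp only [map_add, map_intCast, map_mul, d.ψ_w, goldenConj]
    linear_combination -hxy / 2 + hmv
  have hs2 : s ^ 2 ≤ 1 / 4 := by rw [← sq_abs]; nlinarith [abs_nonneg s]
  have hv2 : v ^ 2 ≤ 1 / 4 := by rw [← sq_abs]; nlinarith [abs_nonneg v]
  have hprod : (v + s * √5 / 2) * (v - s * √5 / 2) = v ^ 2 - 5 / 4 * s ^ 2 := by
    linear_combination (-s ^ 2 / 4) * h5
  have hsum : (v + s * √5 / 2) ^ 2 + (v - s * √5 / 2) ^ 2 = 2 * v ^ 2 + 5 / 2 * s ^ 2 := by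
    linear_combination (s ^ 2 / 2) * h5
  refine ⟨m + n * d.w, ?_, ?_⟩
  · rw [hx, hy, hprod, abs_le]
    constructor <;> nlinarith [sq_nonneg s, sq_nonneg v]
  · rw [hx, hy, hsum]
    nlinarith

lemma exists_norm_sub_mul_lt (x : O) {y : O} (hy : y ≠ 0) :
    ∃ t : O, (d.norm (x - t * y)).natAbs < (d.norm y).natAbs := by
  have h1 : d.φ y ≠ 0 := (map_ne_zero_iff _ d.φ_injective).2 hy
  have h2 : d.ψ y ≠ 0 := (map_ne_zero_iff _ d.ψ_injective).2 hy
  obtain ⟨t, ht, -⟩ := d.exists_near (d.φ x / d.φ y) (d.ψ x / d.ψ y)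
  have hfactor : d.φ (x - t * y) * d.ψ (x - t * y) = ((d.φ x / d.φ y - d.φ t) *
      (d.ψ x / d.ψ y - d.ψ t)) * (d.φ y * d.ψ y) := by
    simp only [map_sub, map_mul]; field_simp
  refine ⟨t, ?_⟩
  rw [← Nat.cast_lt (α := ℝ), Nat.cast_natAbs, Nat.cast_natAbs, Int.cast_abs, Int.cast_abs,
    coe_norm, coe_norm, hfactor, abs_mul]
  nlinarith [abs_pos.2 (mul_ne_zero h1 h2)]

include d in
lemma isPrincipalIdealRing : IsPrincipalIdealRing O := by
  refine ⟨fun I ↦ ?_⟩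
  rcases eq_or_ne I ⊥ with rfl | hI
  · exact bot_isPrincipal
  obtain ⟨y₀, hy₀, hy₀'⟩ := Submodule.exists_mem_ne_zero_of_ne_bot hI
  obtain ⟨y, ⟨hyI, hy⟩, hmin⟩ := WellFounded.has_min
    (InvImage.wf (fun x ↦ (d.norm x).natAbs) Nat.lt_wfRel.wf) {y | y ∈ I ∧ y ≠ 0} ⟨y₀, hy₀, hy₀'⟩
  refine ⟨y, le_antisymm (fun x hx ↦ ?_) ((Ideal.span_singleton_le_iff_mem I).2 hyI)⟩
  obtain ⟨t, ht⟩ := d.exists_norm_sub_mul_lt x hy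
  have hrem : x - t * y ∈ I := I.sub_mem hx (I.mul_mem_left _ hyI)
  by_cases hzero : x - t * y = 0
  · exact Ideal.mem_span_singleton'.2 ⟨t, (sub_eq_zero.1 hzero).symm⟩
  · exact absurd ht (hmin _ ⟨hrem, hzero⟩)

end GoldenData

lemma abs_sq_mul_sub_mul_abs_sq_mul_sub_le {x y a b p q g N δ : ℝ} (hxy : |x * y| ≤ 5 / 16)
    (hxy' : x ^ 2 + y ^ 2 ≤ 9 / 8) (ha : a ^ 2 ≤ g * N) (hb : b ^ 2 ≤ g * N) (hab : |a * b| = N)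
    (hp : |p| ≤ δ) (hq : |q| ≤ δ) :
    |x ^ 2 * a ^ 2 - p| * |y ^ 2 * b ^ 2 - q| ≤
      25 / 256 * N ^ 2 + 9 / 8 * δ * g * N + δ ^ 2 := by
  have hδ : 0 ≤ δ := (abs_nonneg p).trans hp
  have hgN : 0 ≤ g * N := (sq_nonneg a).trans ha
  have hfst : |x ^ 2 * a ^ 2 - p| ≤ x ^ 2 * a ^ 2 + δ :=
    (abs_sub _ _).trans (add_le_add (abs_of_nonneg (by positivity)).le hp)
  have hsnd : |y ^ 2 * b ^ 2 - q| ≤ y ^ 2 * b ^ 2 + δ :=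
    (abs_sub _ _).trans (add_le_add (abs_of_nonneg (by positivity)).le hq)
  have hprod : (x * y) ^ 2 ≤ 25 / 256 := by
    rw [← sq_abs]
    exact (pow_le_pow_left₀ (abs_nonneg _) hxy 2).trans (by norm_num)
  have hsum : x ^ 2 * a ^ 2 + y ^ 2 * b ^ 2 ≤ 9 / 8 * (g * N) :=
    calc x ^ 2 * a ^ 2 + y ^ 2 * b ^ 2 ≤ x ^ 2 * (g * N) + y ^ 2 * (g * N) := by gcongr
      _ = (x ^ 2 + y ^ 2) * (g * N) := by ring
      _ ≤ _ := by gcongr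
  calc |x ^ 2 * a ^ 2 - p| * |y ^ 2 * b ^ 2 - q|
      ≤ (x ^ 2 * a ^ 2 + δ) * (y ^ 2 * b ^ 2 + δ) := by gcongr
    _ = (x * y) ^ 2 * |a * b| ^ 2 + δ * (x ^ 2 * a ^ 2 + y ^ 2 * b ^ 2) + δ ^ 2 := by
      rw [sq_abs]; ring
    _ ≤ 25 / 256 * |a * b| ^ 2 + δ * (9 / 8 * (g * N)) + δ ^ 2 := by gcongr
    _ = _ := by rw [hab]; ring

namespace GoldenData

variable {O : Type*} [CommRing O] (d : GoldenData O)

lemma exists_norm_sq_sub_le {D A : O} (B : O) (hA : A ≠ 0) {δ : ℝ} (h1 : |d.φ D| ≤ δ)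
    (h2 : |d.ψ D| ≤ δ) : ∃ t : O, ((d.norm ((B - t * A) ^ 2 - D)).natAbs : ℝ) ≤
      25 / 256 * ((d.norm A).natAbs : ℝ) ^ 2 +
        9 / 8 * δ * goldenRatio * (d.norm A).natAbs + δ ^ 2 := by
  obtain ⟨k, ha, hb⟩ := d.exists_zpow_balanced A
  set v : O := ↑(d.wUnit ^ k)
  have hAv : A * v ≠ 0 := by
    have := d.isDomain
    exact mul_ne_zero hA (Units.ne_zero _)
  have hN : |d.φ (A * v) * d.ψ (A * v)| = |(d.norm A : ℝ)| := by
    rw [← coe_norm, norm_mul, Int.cast_mul, abs_mul, ← Int.cast_abs (a := d.norm v),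
      ← Nat.cast_natAbs (d.norm v), d.isUnit_iff.1 (Units.isUnit _), Nat.cast_one, mul_one]
  have hφ : d.φ (A * v) ≠ 0 := (map_ne_zero_iff _ d.φ_injective).2 hAv
  have hψ : d.ψ (A * v) ≠ 0 := (map_ne_zero_iff _ d.ψ_injective).2 hAv
  obtain ⟨t, ht1, ht2⟩ := d.exists_near (d.φ B / d.φ (A * v)) (d.ψ B / d.ψ (A * v))
  refine ⟨t * v, ?_⟩
  have hscale (f : O →+* ℝ) (hf : f (A * v) ≠ 0) : f ((B - t * v * A) ^ 2 - D) =
      (f B / f (A * v) - f t) ^ 2 * f (A * v) ^ 2 - f D := by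
    rw [← mul_pow, sub_mul, div_mul_cancel₀ _ hf]
    simp only [map_sub, map_mul, map_pow]
    ring
  rw [Nat.cast_natAbs, Nat.cast_natAbs, Int.cast_abs, Int.cast_abs, coe_norm, hscale _ hφ,
    hscale _ hψ, abs_mul]
  exact abs_sq_mul_sub_mul_abs_sq_mul_sub_le ht1 ht2 ha hb hN h1 h2

/-- Every form `A X² + 2 B X Y + C Y²` with `B² - AC = D` whose leading coefficient is not a unit
can be translated to one whose last coefficient is smaller than `A`, as measured by the norm. -/
def Reducible (D : O) : Prop :=
  ∀ A B : O, A ≠ 0 → ¬ IsUnit A → A ∣ B ^ 2 - D →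
    ∃ t : O, (d.norm ((B - t * A) ^ 2 - D)).natAbs < (d.norm A).natAbs ^ 2

lemma three_lt_norm_natAbs {x : O} (hx : x ≠ 0) (hu : ¬ IsUnit x) : 3 < (d.norm x).natAbs := by
  have h0 := mt d.norm_eq_zero.1 hx
  have h1 := mt d.isUnit_iff.2 hu
  have h2 := d.norm_natAbs_ne (p := 2) (by norm_num) (by decide) x
  have h3 := d.norm_natAbs_ne (p := 3) (by norm_num) (by decide) x
  omega

lemma reducible_neg_one : d.Reducible (-1) := by
  intro A B hA hAu _
  obtain ⟨t, ht⟩ := d.exists_norm_sq_sub_le (D := -1) B hA (δ := 1) (by simp) (by simp)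
  refine ⟨t, ?_⟩
  have hN : (4 : ℝ) ≤ (d.norm A).natAbs := by exact_mod_cast d.three_lt_norm_natAbs hA hAu
  rw [← Nat.cast_lt (α := ℝ), Nat.cast_pow]
  nlinarith [goldenRatio_lt]

lemma dvd_of_dvd_of_norm_natAbs_eq {x y : O} (hx : x ≠ 0) (h : x ∣ y)
    (hn : (d.norm y).natAbs = (d.norm x).natAbs) : y ∣ x := by
  obtain ⟨c, rfl⟩ := h
  rw [norm_mul, Int.natAbs_mul, Nat.mul_eq_left (by simpa [norm_eq_zero] using hx)] at hn
  exact (d.isUnit_iff.2 hn).mul_right_dvd.2 dvd_rfl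

lemma exists_norm_lt_of_dvd_sub {A B B₀ D : O} (h : A ∣ B - B₀)
    (hn : (d.norm (B₀ ^ 2 - D)).natAbs < (d.norm A).natAbs ^ 2) :
    ∃ t : O, (d.norm ((B - t * A) ^ 2 - D)).natAbs < (d.norm A).natAbs ^ 2 := by
  obtain ⟨t, ht⟩ := h
  refine ⟨t, ?_⟩
  rwa [show B - t * A = B₀ by linear_combination ht]

lemma exists_norm_lt_of_norm_eq_four {A B : O} (hA : (d.norm A).natAbs = 4)
    (hd : A ∣ B ^ 2 - d.sqrtFive) :
    ∃ t : O, (d.norm ((B - t * A) ^ 2 - d.sqrtFive)).natAbs < (d.norm A).natAbs ^ 2 := by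
  have := d.charZero
  have h2A : 2 ∣ A := d.two_dvd_of_two_dvd_norm (by omega)
  have hA2 : A ∣ 2 := d.dvd_of_dvd_of_norm_natAbs_eq two_ne_zero h2A
    (by rw [hA, show d.norm 2 = 4 by simpa using d.norm_intCast 2]; rfl)
  have h2B : 2 ∣ (B - 1) ^ 2 := by
    obtain ⟨e, he⟩ := h2A.trans hd
    exact ⟨e - B + d.w, by unfold sqrtFive at he; linear_combination he⟩
  refine d.exists_norm_lt_of_dvd_sub (hA2.trans (d.prime_two.dvd_of_dvd_pow h2B)) ?_
  rw [hA, show (1 : O) ^ 2 - d.sqrtFive = (2 : ℤ) + (-2 : ℤ) * d.w by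
    rw [sqrtFive]; push_cast; ring, norm_add_mul_w]
  norm_num

lemma exists_norm_lt_of_norm_eq_five {A B : O} (hA : (d.norm A).natAbs = 5)
    (hd : A ∣ B ^ 2 - d.sqrtFive) :
    ∃ t : O, (d.norm ((B - t * A) ^ 2 - d.sqrtFive)).natAbs < (d.norm A).natAbs ^ 2 := by
  have hrA : d.sqrtFive ∣ A := d.sqrtFive_dvd_of_five_dvd_norm (by omega)
  have hAr : A ∣ d.sqrtFive := d.dvd_of_dvd_of_norm_natAbs_eq d.prime_sqrtFive.ne_zero hrA
    (by rw [hA, norm_sqrtFive]; rfl)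
  have hrB : d.sqrtFive ∣ B ^ 2 := (dvd_sub_left dvd_rfl).1 (hrA.trans hd)
  refine d.exists_norm_lt_of_dvd_sub (B₀ := 0) ?_ ?_
  · rw [sub_zero]
    exact hAr.trans (d.prime_sqrtFive.dvd_of_dvd_pow hrB)
  · rw [hA, show (0 : O) ^ 2 - d.sqrtFive = (1 : ℤ) + (-2 : ℤ) * d.w by
      rw [sqrtFive]; push_cast; ring, norm_add_mul_w]
    norm_num

/-- The general bound reduces leading coefficients of norm at least `6`. By inertness of `2` and `3`
only the associates of `2` and `√5` remain, and these are treated by hand. -/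
lemma reducible_sqrtFive : d.Reducible d.sqrtFive := by
  intro A B hA hAu hd
  have hN3 := d.three_lt_norm_natAbs hA hAu
  by_cases hN4 : (d.norm A).natAbs = 4
  · exact d.exists_norm_lt_of_norm_eq_four hN4 hd
  by_cases hN5 : (d.norm A).natAbs = 5
  · exact d.exists_norm_lt_of_norm_eq_five hN5 hd
  obtain ⟨t, ht⟩ := d.exists_norm_sq_sub_le (D := d.sqrtFive) B hA (δ := √5)
    (by rw [φ_sqrtFive, abs_of_nonneg (by positivity)])
    (by rw [ψ_sqrtFive, abs_neg, abs_of_nonneg (by positivity)])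
  refine ⟨t, ?_⟩
  have hN : (6 : ℝ) ≤ (d.norm A).natAbs := by
    exact_mod_cast (show 6 ≤ (d.norm A).natAbs by omega)
  have hsqrt : √5 < 2.24 := by
    rw [Real.sqrt_lt' (by norm_num)]; norm_num
  have hprod : √5 * goldenRatio ≤ 2.24 * 1.62 := by
    have := Real.goldenRatio_pos
    have := goldenRatio_lt
    gcongr
  rw [Real.sq_sqrt (by norm_num)] at ht
  rw [← Nat.cast_lt (α := ℝ), Nat.cast_pow]
  nlinarith [mul_le_mul_of_nonneg_right hprod (by positivity : (0 : ℝ) ≤ (d.norm A).natAbs)]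

end GoldenData

/-! ### Quadratic extensions of principal ideal domains -/

section QuadraticExtension

variable {R : Type*} [CommRing R] {D : R}

lemma isPrincipal_of_span_singleton_mul_eq [IsDomain R] {a b : R} {I : Ideal R} (ha : a ≠ 0)
    (h : Ideal.span {a} * I = Ideal.span {b}) : I.IsPrincipal := by
  obtain ⟨i, hi, rfl⟩ : ∃ i ∈ I, a * i = b :=
    Ideal.mem_span_singleton_mul.1 (h ▸ Ideal.mem_span_singleton_self b)
  refine ⟨i, le_antisymm (fun x hx ↦ ?_) ((Ideal.span_singleton_le_iff_mem I).2 hi)⟩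
  have hax : a * x ∈ Ideal.span {a * i} :=
    h ▸ Ideal.mul_mem_mul (Ideal.mem_span_singleton_self a) hx
  rw [Ideal.mem_span_singleton] at hax
  exact Ideal.mem_span_singleton.2 ((mul_dvd_mul_iff_left ha).1 hax)

lemma eq_zero_of_quadraticNorm_eq_zero {f : R →+* ℝ} (hf : Function.Injective f) (hD : f D < 0)
    {z : QuadraticAlgebra R D 0} (h : z.norm = 0) : z = 0 := by
  rw [QuadraticAlgebra.norm_def] at h
  replace h := congrArg f h
  simp only [zero_mul, add_zero, map_sub, map_mul, map_zero] at h
  have hre : f z.re ^ 2 = 0 := by nlinarith [sq_nonneg (f z.re), sq_nonneg (f z.im)]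
  have him : f z.im ^ 2 = 0 := by nlinarith [sq_nonneg (f z.re), sq_nonneg (f z.im)]
  ext
  · exact (map_eq_zero_iff _ hf).1 (pow_eq_zero_iff two_ne_zero |>.1 hre)
  · exact (map_eq_zero_iff _ hf).1 (pow_eq_zero_iff two_ne_zero |>.1 him)

lemma isDomain_quadraticAlgebra [IsDomain R] {a b : R}
    (h0 : ∀ z : QuadraticAlgebra R a b, z.norm = 0 → z = 0) :
    IsDomain (QuadraticAlgebra R a b) := by
  have : NoZeroDivisors (QuadraticAlgebra R a b) := ⟨fun {z z'} h ↦ by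
    replace h := congrArg QuadraticAlgebra.norm h
    rw [map_mul, QuadraticAlgebra.norm_zero, mul_eq_zero] at h
    exact h.imp (h0 z) (h0 z')⟩
  exact NoZeroDivisors.to_isDomain _

lemma exists_mem_im_dvd [IsPrincipalIdealRing R] (I : Ideal (QuadraticAlgebra R D 0)) :
    ∃ z ∈ I, ∀ x ∈ I, z.im ∣ x.re ∧ z.im ∣ x.im := by
  let imIdeal : Ideal R :=
    Submodule.map (QuadraticAlgebra.imₗ (R := R) (a := D) (b := 0)) (I.restrictScalars R)
  obtain ⟨h, hh⟩ := IsPrincipalIdealRing.principal imIdeal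
  obtain ⟨z, hz, rfl⟩ : h ∈ imIdeal := hh ▸ Ideal.mem_span_singleton_self h
  have him (x) (hx : x ∈ I) : z.im ∣ x.im := by
    have hmem : x.im ∈ imIdeal := ⟨x, hx, rfl⟩
    rw [hh] at hmem
    exact Ideal.mem_span_singleton.1 hmem
  refine ⟨z, hz, fun x hx ↦ ⟨?_, him x hx⟩⟩
  simpa using him _ (I.mul_mem_left (⟨0, 1⟩ : QuadraticAlgebra R D 0) hx)

lemma exists_algebraMap_mem_dvd [IsPrincipalIdealRing R] {a b : R}
    (h0 : ∀ z : QuadraticAlgebra R a b, z.norm = 0 → z = 0)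
    {I : Ideal (QuadraticAlgebra R a b)} (hI : I ≠ ⊥) :
    ∃ c : R, c ≠ 0 ∧ algebraMap R _ c ∈ I ∧ ∀ x : R, algebraMap R _ x ∈ I → c ∣ x := by
  obtain ⟨c, hc⟩ := IsPrincipalIdealRing.principal (I.comap (algebraMap R _))
  rw [Ideal.submodule_span_eq] at hc
  have hdvd (x : R) (hx : algebraMap R _ x ∈ I) : c ∣ x :=
    Ideal.mem_span_singleton.1 (hc ▸ Ideal.mem_comap.2 hx)
  refine ⟨c, ?_, Ideal.mem_comap.1 (hc ▸ Ideal.mem_span_singleton_self c), hdvd⟩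
  rintro rfl
  obtain ⟨z, hz, hz0⟩ := Submodule.exists_mem_ne_zero_of_ne_bot hI
  refine hz0 (h0 z (zero_dvd_iff.1 (hdvd _ ?_)))
  rw [QuadraticAlgebra.algebraMap_norm_eq_mul_star]
  exact I.mul_mem_right _ hz

lemma exists_eq_span_singleton_mul_span_pair [IsDomain R] [IsPrincipalIdealRing R]
    (h0 : ∀ z : QuadraticAlgebra R D 0, z.norm = 0 → z = 0)
    {I : Ideal (QuadraticAlgebra R D 0)} (hI : I ≠ ⊥) :
    ∃ h A B : R, A ≠ 0 ∧ A ∣ B ^ 2 - D ∧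
      I = Ideal.span {algebraMap R _ h} * Ideal.span {algebraMap R _ A, ⟨B, 1⟩} := by
  set ι := algebraMap R (QuadraticAlgebra R D 0)
  obtain ⟨z, hz, hdvd⟩ := exists_mem_im_dvd I
  obtain ⟨a, ha0, haI, hmem⟩ := exists_algebraMap_mem_dvd h0 hI
  obtain ⟨h, hzh⟩ : ∃ h, z.im = h := ⟨_, rfl⟩
  rw [hzh] at hdvd
  obtain ⟨A, rfl⟩ : h ∣ a := (hdvd _ haI).1
  obtain ⟨B, hB⟩ : h ∣ z.re := (hdvd _ hz).1
  have hz_eq : z = ι h * ⟨B, 1⟩ := by ext <;> simp [ι, hB, hzh]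
  refine ⟨h, A, B, right_ne_zero_of_mul ha0, ?_, ?_⟩
  · have hnorm : ι (h * (B ^ 2 - D)) = z * ⟨B, -1⟩ := by
      rw [hz_eq]
      ext
      · simp only [ι, QuadraticAlgebra.algebraMap_re]
        simp
        ring
      · simp only [ι, QuadraticAlgebra.algebraMap_im]
        simp
    exact (mul_dvd_mul_iff_left (left_ne_zero_of_mul ha0)).1
      (hmem _ (hnorm ▸ I.mul_mem_right _ hz))
  · rw [Ideal.span_mul_span', Set.singleton_mul, Set.image_pair, ← hz_eq, ← map_mul]
    refine le_antisymm (fun x hx ↦ ?_) (Ideal.span_le.2 ?_)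
    · obtain ⟨c, hc⟩ := (hdvd x hx).2
      have hsub : x - ι c * z = ι (x.re - c * z.re) := by
        ext <;> simp [ι, hc, hzh]; ring
      obtain ⟨e, he⟩ := hmem _ (hsub ▸ I.sub_mem hx (I.mul_mem_left _ hz))
      refine Ideal.mem_span_pair.2 ⟨ι e, ι c, ?_⟩
      rw [← map_mul, mul_comm e, ← he, ← hsub, sub_add_cancel]
    · rintro x (rfl | rfl)
      exacts [haI, hz]

/-- Reduction step: `(A, B + √D)` and `(C, -B + √D)` differ by a principal factor if
`AC = D - B²`. -/
lemma span_singleton_mul_span_pair_eq {A B C : R} (h : D - B ^ 2 = A * C) :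
    Ideal.span {(⟨-B, 1⟩ : QuadraticAlgebra R D 0)} * Ideal.span {algebraMap R _ A, ⟨B, 1⟩} =
      Ideal.span {algebraMap R _ A} * Ideal.span {algebraMap R _ C, ⟨-B, 1⟩} := by
  rw [Ideal.span_mul_span', Ideal.span_mul_span', Set.singleton_mul, Set.singleton_mul,
    Set.image_pair, Set.image_pair, Set.pair_comm]
  congr 2
  · ext
    · simp
      linear_combination h
    · simp
  · simp [mul_comm]

lemma dvd_quadraticNorm_of_mem_span_pair {l s : R} (hs : l ∣ s ^ 2 - D)
    {z : QuadraticAlgebra R D 0} (hz : z ∈ Ideal.span {algebraMap R _ l, ⟨s, 1⟩}) :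
    l ∣ z.norm := by
  obtain ⟨p, q, rfl⟩ := Ideal.mem_span_pair.1 hz
  obtain ⟨e, he⟩ := hs
  refine ⟨(p.re ^ 2 - D * p.im ^ 2) * l + 2 * (s * (p.re * q.re - D * (p.im * q.im)) +
    D * (p.re * q.im - p.im * q.re)) + (q.re ^ 2 - D * q.im ^ 2) * e, ?_⟩
  rw [QuadraticAlgebra.norm_def]
  simp
  linear_combination (q.re ^ 2 - D * q.im ^ 2) * he

lemma associated_quadraticNorm_of_span_pair_eq [IsDomain R] {l s : R} (hl : Prime l)
    (hs : l ∣ s ^ 2 - D) {g : QuadraticAlgebra R D 0}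
    (hg : Ideal.span {algebraMap R _ l, ⟨s, 1⟩} = Ideal.span {g}) : Associated l g.norm := by
  obtain ⟨μ, hμ⟩ : g ∣ algebraMap R _ l :=
    Ideal.mem_span_singleton.1 (hg ▸ Ideal.subset_span (by simp))
  obtain ⟨ν, hν⟩ : g ∣ ⟨s, 1⟩ := Ideal.mem_span_singleton.1 (hg ▸ Ideal.subset_span (by simp))
  obtain ⟨e, he⟩ := dvd_quadraticNorm_of_mem_span_pair hs (hg ▸ Ideal.mem_span_singleton_self g)
  have hprod : g.norm * μ.norm = l ^ 2 := by
    rw [← map_mul, ← hμ, QuadraticAlgebra.norm_algebraMap]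
  have hl_eq : l = e * μ.norm := by
    refine mul_left_cancel₀ hl.ne_zero ?_
    rw [← mul_assoc, ← he, hprod, sq]
  rcases hl.irreducible.isUnit_or_isUnit hl_eq with hunit | hunit
  · rw [he]
    exact (associated_mul_unit_right l e hunit)
  · have hgl : algebraMap R _ l ∣ g := by
      rw [hμ]
      exact (QuadraticAlgebra.isUnit_iff_norm_isUnit.2 hunit).mul_right_dvd.2 dvd_rfl
    exact absurd (QuadraticAlgebra.algebraMap_dvd_iff.1 (hgl.trans (hν ▸ dvd_mul_right g ν))).2
      hl.not_dvd_one

end QuadraticExtension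

namespace GoldenData

variable {O : Type*} [CommRing O] (d : GoldenData O) {D : O}

lemma isPrincipal_span_pair (h0 : ∀ z : QuadraticAlgebra O D 0, z.norm = 0 → z = 0)
    (hred : d.Reducible D) {A : O} (B : O) (hA : A ≠ 0) (hd : A ∣ B ^ 2 - D) :
    (Ideal.span {algebraMap O (QuadraticAlgebra O D 0) A, ⟨B, 1⟩}).IsPrincipal := by
  have := d.isDomain
  have := isDomain_quadraticAlgebra h0
  induction hn : (d.norm A).natAbs using Nat.strong_induction_on generalizing A B with
  | _ n ih =>
  by_cases hAu : IsUnit A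
  · rw [Ideal.eq_top_of_isUnit_mem _ (Ideal.subset_span (Set.mem_insert _ _))
      (hAu.map (algebraMap O (QuadraticAlgebra O D 0)))]
    exact top_isPrincipal
  obtain ⟨t, ht⟩ := hred A B hA hAu hd
  obtain ⟨B', hB'⟩ : ∃ B', B' = B - t * A := ⟨_, rfl⟩
  rw [← hB'] at ht
  have htranslate : Ideal.span {algebraMap O (QuadraticAlgebra O D 0) A, ⟨B, 1⟩} =
      Ideal.span {algebraMap O (QuadraticAlgebra O D 0) A, ⟨B', 1⟩} := by
    have hshift : (⟨B, 1⟩ : QuadraticAlgebra O D 0) =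
        ⟨B', 1⟩ + algebraMap _ _ A * algebraMap _ _ t := by
      ext <;> simp [hB']; ring
    rw [hshift, Ideal.span_pair_add_left_mul]
  obtain ⟨C, hC⟩ : A ∣ D - B' ^ 2 := by
    obtain ⟨e, he⟩ := hd
    exact ⟨-(e - 2 * t * B + t ^ 2 * A), by rw [hB']; linear_combination -he⟩
  have hC0 : C ≠ 0 := by
    rintro rfl
    refine one_ne_zero (congrArg QuadraticAlgebra.im (h0 ⟨B', 1⟩ ?_))
    rw [QuadraticAlgebra.norm_def]
    linear_combination -hC
  have hlt : (d.norm C).natAbs < n := by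
    rw [show B' ^ 2 - D = (-1 : ℤ) * (A * C) by push_cast; linear_combination -hC, norm_mul,
      norm_intCast, norm_mul, neg_one_sq, one_mul, Int.natAbs_mul, sq, hn] at ht
    exact lt_of_mul_lt_mul_left ht (Nat.zero_le _)
  obtain ⟨g, hg⟩ := ih _ hlt (-B') hC0 ⟨-A, by linear_combination -hC⟩ rfl
  rw [htranslate]
  refine isPrincipal_of_span_singleton_mul_eq (a := (⟨-B', 1⟩ : QuadraticAlgebra O D 0))
    (b := algebraMap _ _ A * g) (fun h ↦ one_ne_zero (congrArg QuadraticAlgebra.im h)) ?_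
  rw [span_singleton_mul_span_pair_eq hC, hg, Ideal.submodule_span_eq,
    Ideal.span_singleton_mul_span_singleton]

lemma isPrincipalIdealRing_quadraticAlgebra
    (h0 : ∀ z : QuadraticAlgebra O D 0, z.norm = 0 → z = 0) (hred : d.Reducible D) :
    IsPrincipalIdealRing (QuadraticAlgebra O D 0) := by
  have := d.isDomain
  have := d.isPrincipalIdealRing
  refine ⟨fun I ↦ ?_⟩
  rcases eq_or_ne I ⊥ with rfl | hI
  · exact bot_isPrincipal
  obtain ⟨h, A, B, hA, hd, rfl⟩ := exists_eq_span_singleton_mul_span_pair h0 hI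
  obtain ⟨g, hg⟩ := d.isPrincipal_span_pair h0 hred B hA hd
  rw [hg, Ideal.submodule_span_eq, Ideal.span_singleton_mul_span_singleton]
  exact ⟨_, rfl⟩

lemma exists_eq_mul_norm (h0 : ∀ z : QuadraticAlgebra O D 0, z.norm = 0 → z = 0)
    (hred : d.Reducible D) {l s : O} (hl : Prime l) (hs : l ∣ s ^ 2 - D) :
    ∃ ε x y : O, IsUnit ε ∧ l = ε * (x ^ 2 - D * y ^ 2) := by
  have := d.isDomain
  obtain ⟨g, hg⟩ := d.isPrincipal_span_pair h0 hred s hl.ne_zero hs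
  obtain ⟨ε, hε⟩ := (associated_quadraticNorm_of_span_pair_eq hl hs hg).symm
  refine ⟨ε, g.re, g.im, ε.isUnit, ?_⟩
  rw [← hε, QuadraticAlgebra.norm_def]
  ring

end GoldenData

/-! ### Divisibility and squares -/

lemma two_dvd_sub_of_two_dvd_sq_sub_sq {R : Type*} [CommRing R] (h2 : Prime (2 : R)) {x y : R}
    (h : 2 ∣ x ^ 2 - y ^ 2) : 2 ∣ x - y := by
  obtain ⟨e, he⟩ := h
  exact h2.dvd_of_dvd_pow (n := 2) ⟨e - y * (x - y), by linear_combination he⟩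

section IntegrallyClosed

variable {R : Type*} [CommRing R] [IsDomain R]

lemma dvd_of_mul_sq_eq_prime_mul_sq [IsIntegrallyClosed R] {l s T N : R} (hl : Prime l)
    (h : T * N ^ 2 = l * s ^ 2) : N ∣ s := by
  rcases eq_or_ne N 0 with rfl | hN
  · have hs : s ^ 2 = 0 := by
      refine (mul_eq_zero.1 ?_).resolve_left hl.ne_zero
      linear_combination -h
    rw [pow_eq_zero_iff two_ne_zero |>.1 hs]
  obtain ⟨W, hW⟩ : N ∣ l * s :=
    (IsIntegrallyClosed.pow_dvd_pow_iff two_ne_zero).1 ⟨l * T, by linear_combination -l * h⟩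
  have hWsq : l * T = W ^ 2 := by
    refine mul_right_cancel₀ (pow_ne_zero 2 hN) ?_
    linear_combination l * h + (l * s + N * W) * hW
  obtain ⟨v, rfl⟩ : l ∣ W := hl.dvd_of_dvd_pow ⟨T, hWsq.symm⟩
  exact ⟨v, mul_left_cancel₀ hl.ne_zero (by linear_combination hW)⟩

lemma exists_algebraMap_eq_of_prime_mul_sq [IsIntegrallyClosed R] {K : Type*} [Field K]
    [Algebra R K] [IsFractionRing R K] {l T : R} (hl : Prime l) {b : K}
    (h : algebraMap R K l * b ^ 2 = algebraMap R K T) : ∃ v, algebraMap R K v = b := by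
  obtain ⟨s, N, hN, rfl⟩ := IsFractionRing.div_surjective (A := R) b
  have hN0 := IsFractionRing.to_map_ne_zero_of_mem_nonZeroDivisors (K := K) hN
  obtain ⟨v, rfl⟩ : N ∣ s := by
    refine dvd_of_mul_sq_eq_prime_mul_sq (T := T) hl (IsFractionRing.injective R K ?_)
    rw [div_pow, mul_div_assoc', div_eq_iff (pow_ne_zero 2 hN0)] at h
    simpa only [map_mul, map_pow] using h.symm
  exact ⟨v, by rw [map_mul, mul_div_cancel_left₀ _ hN0]⟩

lemma dvd_of_sq_sub_mul_add_eq_zero [IsIntegrallyClosed R] {n s p v : R}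
    (h : v ^ 2 - n * s * v + n ^ 2 * p = 0) : n ∣ v := by
  rcases eq_or_ne n 0 with rfl | hn
  · have hv : v ^ 2 = 0 := by linear_combination h
    rw [pow_eq_zero_iff two_ne_zero |>.1 hv]
  have hn' : algebraMap R (FractionRing R) n ≠ 0 := by simpa using hn
  obtain ⟨c, hc⟩ := IsIntegrallyClosed.isIntegral_iff (R := R) (K := FractionRing R)
    (x := algebraMap R _ v / algebraMap R _ n) |>.1 <| by
      refine ⟨Polynomial.X ^ 2 - Polynomial.C s * Polynomial.X + Polynomial.C p, by monicity!, ?_⟩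
      replace h := congrArg (algebraMap R (FractionRing R)) h
      simp only [map_add, map_sub, map_mul, map_pow, map_zero] at h
      simp only [Polynomial.eval₂_add, Polynomial.eval₂_sub, Polynomial.eval₂_mul,
        Polynomial.eval₂_pow, Polynomial.eval₂_X, Polynomial.eval₂_C]
      field_simp
      linear_combination h
  refine ⟨c, IsFractionRing.injective R (FractionRing R) ?_⟩
  rw [map_mul, hc, mul_div_cancel₀ _ hn']

lemma exists_dvd_sq_sub [IsPrincipalIdealRing R] {l D a b : R} (hl : Prime l) (hb : ¬ l ∣ b)
    (h : l ∣ D * b ^ 2 - a ^ 2) : ∃ t, l ∣ t ^ 2 - D := by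
  obtain ⟨p, q, hpq⟩ := hl.irreducible.coprime_iff_not_dvd.2 hb
  obtain ⟨e, he⟩ := h
  refine ⟨q * a, -(q ^ 2 * e) - D * p * (q * b + 1), ?_⟩
  linear_combination -q ^ 2 * he + D * (q * b + 1) * hpq

end IntegrallyClosed

namespace GoldenData

variable {O : Type*} [CommRing O] {d : GoldenData O} {l a b : O}

/-! ### The form `w (√5 b² - a²)` -/

variable (d) in
/-- Representability of `l` by `w (√5 b² - a²)`, the form `q` in integral coordinates. -/
def Rep (l : O) : Prop := ∃ a b : O, l = d.w * (d.sqrtFive * b ^ 2 - a ^ 2)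

lemma two_dvd_add_sub_w (h : l = d.w * (d.sqrtFive * b ^ 2 - a ^ 2)) (h4 : 4 ∣ l + 1) :
    2 ∣ a + b - d.w := by
  obtain ⟨f, hf⟩ := h4
  refine two_dvd_sub_of_two_dvd_sq_sub_sq d.prime_two
    ⟨d.w * b ^ 2 - 2 * f * (d.w - 1) + a * b - 1, ?_⟩
  unfold sqrtFive at h
  linear_combination (d.w - 1) * h - (d.w - 1) * hf +
    ((2 * d.w - 1) * b ^ 2 - a ^ 2 - 1) * d.w_sq

lemma two_dvd_sub_one_mul_sub_w (h : l = d.w * (d.sqrtFive * b ^ 2 - a ^ 2)) (h4 : 4 ∣ l + 1) :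
    2 ∣ (b - 1) * (b - d.w) := by
  have := d.isDomain
  obtain ⟨e, he⟩ := two_dvd_add_sub_w h h4
  obtain ⟨f, hf⟩ := h4
  refine (mul_dvd_mul_iff_left d.prime_two.ne_zero).1
    ⟨f + d.w * e ^ 2 + d.w ^ 2 * e - d.w * b * e - (d.w + 1) * b + d.w, ?_⟩
  obtain rfl : a = d.w - b + 2 * e := by linear_combination he
  unfold sqrtFive at h
  linear_combination hf - h + (-2 * b ^ 2 - 2 * b + d.w + 1) * d.w_sq

variable (d) in
/-- Multiplication of `a + b √√5` by the unit `w² + w √√5` of relative norm `1`. -/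
lemma w_mul_sqrtFive_mul_sq_sub_sq (a b : O) :
    d.w * (d.sqrtFive * (a * d.w + b * d.w ^ 2) ^ 2 -
      (a * d.w ^ 2 + b * d.w * d.sqrtFive) ^ 2) = d.w * (d.sqrtFive * b ^ 2 - a ^ 2) := by
  have hunit : d.w ^ 4 - d.sqrtFive * d.w ^ 2 = 1 := by
    unfold sqrtFive
    linear_combination (d.w ^ 2 - d.w + 1) * d.w_sq
  linear_combination (d.w * d.sqrtFive * b ^ 2 - a ^ 2 * d.w) * hunit

lemma Rep.exists_two_dvd (h : d.Rep l) (h4 : 4 ∣ l + 1) :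
    ∃ a b : O, l = d.w * (d.sqrtFive * b ^ 2 - a ^ 2) ∧ 2 ∣ a ∧ 2 ∣ b - d.w := by
  obtain ⟨a, b, h⟩ := h
  obtain ⟨e, he⟩ := two_dvd_add_sub_w h h4
  rcases d.prime_two.dvd_or_dvd (two_dvd_sub_one_mul_sub_w h h4) with ⟨c, hc⟩ | ⟨c, hc⟩
  · refine ⟨_, _, h.trans (d.w_mul_sqrtFive_mul_sq_sub_sq a b).symm,
      ⟨d.w ^ 2 * (e - c) + c * d.w * d.sqrtFive + d.w ^ 2, ?_⟩,
      ⟨d.w * (e - c) + c * d.w ^ 2 + 1, ?_⟩⟩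
    all_goals
      obtain rfl : b = 1 + 2 * c := by linear_combination hc
      obtain rfl : a = d.w - (1 + 2 * c) + 2 * e := by linear_combination he
    · unfold sqrtFive
      linear_combination d.w * d.w_sq
    · linear_combination 2 * d.w_sq
  · exact ⟨a, b, h, ⟨e - c, by linear_combination he - hc⟩, ⟨c, hc⟩⟩

lemma Rep.exists_dvd_sq_sub (hl : Prime l) (h : d.Rep l) : ∃ t, l ∣ t ^ 2 - d.sqrtFive := by
  have := d.isDomain
  have := d.isPrincipalIdealRing
  obtain ⟨a, b, h⟩ := h
  have hdvd : l ∣ d.sqrtFive * b ^ 2 - a ^ 2 := (d.isUnit_w.dvd_mul_left).1 h.dvd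
  refine QuadRep.exists_dvd_sq_sub hl (fun hb ↦ ?_) hdvd
  have ha : l ∣ a := hl.dvd_of_dvd_pow (n := 2)
    ((dvd_sub_right ((hb.trans (dvd_pow_self b two_ne_zero)).mul_left _)).1 hdvd)
  have hsq : l * l ∣ l * 1 := by
    rw [mul_one, ← sq]
    nth_rw 2 [h]
    exact (((pow_dvd_pow_of_dvd hb 2).mul_left _).sub (pow_dvd_pow_of_dvd ha 2)).mul_left _
  exact hl.not_dvd_one ((mul_dvd_mul_iff_left hl.ne_zero).1 hsq)

lemma Rep.exists_dvd_sq_add_one (hl : Prime l) (hr : ¬ l ∣ d.sqrtFive) (h : d.Rep l)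
    (h' : d.conj.Rep l) : ∃ s, l ∣ s ^ 2 + 1 := by
  have := d.isDomain
  have := d.isPrincipalIdealRing
  obtain ⟨t, ht⟩ := h.exists_dvd_sq_sub hl
  obtain ⟨t', ht'⟩ := h'.exists_dvd_sq_sub hl
  rw [conj_sqrtFive, sub_neg_eq_add] at ht'
  have ht'0 : ¬ l ∣ t' := fun hdvd ↦
    hr ((dvd_add_right (hdvd.trans (dvd_pow_self t' two_ne_zero))).1 ht')
  obtain ⟨s, hs⟩ := QuadRep.exists_dvd_sq_sub (D := -1) (a := t) hl ht'0 (by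
    rw [show -1 * t' ^ 2 - t ^ 2 = -((t ^ 2 - d.sqrtFive) + (t' ^ 2 + d.sqrtFive)) by ring]
    exact (ht.add ht').neg_right)
  exact ⟨s, by rwa [sub_neg_eq_add] at hs⟩

variable (d) in
lemma sqrtFive_dvd_w_sub_three : d.sqrtFive ∣ d.w - 3 :=
  ⟨1 - d.w, by unfold sqrtFive; linear_combination 2 * d.w_sq⟩

/-- Modulo `√5`, an element of the form `w (√5 b² - a²)` is twice a square. -/
lemma Rep.not_sqrtFive_dvd_sq_sub {x : O} (h : d.Rep l) (hr : ¬ d.sqrtFive ∣ l) :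
    ¬ d.sqrtFive ∣ x ^ 2 - l := by
  rintro ⟨f, hf⟩
  obtain ⟨a, b, h⟩ := h
  obtain ⟨c, hc⟩ := d.sqrtFive_dvd_w_sub_three
  have hmod : d.sqrtFive ∣ x ^ 2 - 2 * a ^ 2 :=
    ⟨f + d.w * b ^ 2 - c * a ^ 2 - d.sqrtFive * a ^ 2, by
      linear_combination hf + h - a ^ 2 * hc + a ^ 2 * d.sqrtFive_sq⟩
  have ha := (d.sqrtFive_dvd_of_sq_sub_two_mul_sq hmod).trans (dvd_pow_self a two_ne_zero)
  exact hr (h ▸ ((dvd_mul_right _ _).sub ha).mul_left _)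

end GoldenData

/-! ### Sums of two squares over `O[√(-√5)]` -/

section SumOfTwoSquares

variable {R : Type*} [CommRing R] {D l c x : R} {z : QuadraticAlgebra R D 0}

lemma norm_algebraMap_sq_add_sq (h1 : l = c ^ 2 + D * z.im ^ 2) (h2 : l = x ^ 2 + z.re ^ 2) :
    (algebraMap R (QuadraticAlgebra R D 0) (c + x) ^ 2 + z ^ 2).norm = l * (2 * (c + x)) ^ 2 := by
  have hsq : algebraMap R (QuadraticAlgebra R D 0) (c + x) ^ 2 + z ^ 2 =
      ⟨(c + x) ^ 2 + z.re ^ 2 + D * z.im ^ 2, 2 * z.re * z.im⟩ := by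
    rw [sq, sq, sq, ← map_mul]
    ext
    · simp [-map_mul, -map_add]; ring
    · simp [-map_mul, -map_add]; ring
  have hre : z.re ^ 2 = l - x ^ 2 := by linear_combination -h2
  have him : D * z.im ^ 2 = l - c ^ 2 := by linear_combination -h1
  rw [hsq, QuadraticAlgebra.norm_def]
  linear_combination ((c + x) ^ 2 + z.re ^ 2 + D * z.im ^ 2 + 2 * l + 2 * c * x) * (hre + him) -
    4 * D * z.im ^ 2 * hre - 4 * (l - x ^ 2) * him

/-- By hypothesis `l` is a norm from both `R[i]` and `R[√(-D)]`. Then `c + x` divides `z z̄`, and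
`j` and `k` come from a factorization `c + x = j m` with `j ∣ z` and `z̄ = m k`. -/
lemma exists_norm_sq_add_sq_eq [IsDomain R] [IsIntegrallyClosed R]
    [DecompositionMonoid (QuadraticAlgebra R D 0)]
    (hl : Prime l) (h1 : l = c ^ 2 + D * z.im ^ 2) (h2 : l = x ^ 2 + z.re ^ 2)
    (h0 : c + x ≠ 0) :
    ∃ (j k : QuadraticAlgebra R D 0) (v : R), v ∣ 2 ^ 2 ∧ (j ^ 2 + k ^ 2).norm = l * v ^ 2 := by
  have hnorm := norm_algebraMap_sq_add_sq h1 h2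
  set s := c + x
  have hzz : algebraMap R (QuadraticAlgebra R D 0) s ∣ z * star z := by
    rw [← QuadraticAlgebra.algebraMap_norm_eq_mul_star, QuadraticAlgebra.norm_def]
    exact map_dvd _ ⟨c - x, by linear_combination h1 - h2⟩
  obtain ⟨j, m, ⟨n, hn⟩, ⟨k, hk⟩, hjm⟩ := exists_dvd_and_dvd_of_dvd_mul hzz
  have hnorm_star : ((j * m) ^ 2 + star z ^ 2).norm = l * (2 * s) ^ 2 := by
    have hstar : star (algebraMap R (QuadraticAlgebra R D 0) s) = algebraMap R _ s := by
      ext <;> simp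
    rw [← hnorm, ← QuadraticAlgebra.norm_star, star_add, star_pow, star_pow, star_star, ← hjm,
      hstar]
  have hT : (j ^ 2 + k ^ 2).norm * m.norm ^ 2 = l * (2 * s) ^ 2 := by
    rw [← hnorm_star, hk, ← map_pow, ← map_mul]
    congr 1; ring
  have hT' : (m ^ 2 + n ^ 2).norm * j.norm ^ 2 = l * (2 * s) ^ 2 := by
    rw [← hnorm, hjm, hn, ← map_pow, ← map_mul]
    congr 1; ring
  have hNjm : j.norm * m.norm = s ^ 2 := by
    rw [← map_mul, ← hjm, QuadraticAlgebra.norm_algebraMap]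
  obtain ⟨v, hv⟩ := dvd_of_mul_sq_eq_prime_mul_sq hl hT
  obtain ⟨v', hv'⟩ := dvd_of_mul_sq_eq_prime_mul_sq hl hT'
  have hs0 : s ^ 2 ≠ 0 := pow_ne_zero 2 h0
  refine ⟨j, k, v, ⟨v', mul_left_cancel₀ hs0 ?_⟩, ?_⟩
  · linear_combination 2 * s * hv + m.norm * v * hv' + v * v' * hNjm
  · refine mul_right_cancel₀ (pow_ne_zero 2 (right_ne_zero_of_mul (hNjm ▸ hs0))) ?_
    linear_combination hT + l * (2 * s + m.norm * v) * hv

lemma quadraticNorm_two {a b : R} :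
    QuadraticAlgebra.norm (2 : QuadraticAlgebra R a b) = 2 ^ 2 := by
  simpa only [Nat.cast_ofNat] using QuadraticAlgebra.norm_natCast (R := R) (a := a) (b := b) 2

end SumOfTwoSquares

namespace GoldenData

variable {O : Type*} [CommRing O] {d : GoldenData O}

lemma two_dvd_of_four_dvd_quadraticNorm {z : QuadraticAlgebra O (-d.sqrtFive) 0}
    (h : 4 ∣ z.norm) : 2 ∣ z := by
  have := d.isDomain
  have h2 := d.prime_two
  obtain ⟨f, hf⟩ := h
  rw [QuadraticAlgebra.norm_def] at hf
  unfold sqrtFive at hf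
  obtain ⟨e, he⟩ : 2 ∣ z.re - z.im :=
    two_dvd_sub_of_two_dvd_sq_sub_sq h2 ⟨2 * f - d.w * z.im ^ 2, by linear_combination hf⟩
  have him : 2 ∣ d.w * z.im ^ 2 := (mul_dvd_mul_iff_left h2.ne_zero).1
    ⟨f - z.im * e - e ^ 2, by linear_combination hf - (z.re + z.im + 2 * e) * he⟩
  obtain ⟨g, hg⟩ := h2.dvd_of_dvd_pow ((d.isUnit_w.dvd_mul_left).1 him)
  refine QuadraticAlgebra.ext_iff.2 ?_ |> Dvd.intro ⟨e + g, g⟩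
  rw [QuadraticAlgebra.re_mul, QuadraticAlgebra.im_mul, QuadraticAlgebra.re_ofNat,
    QuadraticAlgebra.im_ofNat]
  constructor
  · linear_combination -he - hg
  · linear_combination -hg

lemma two_pow_dvd_of_sq_dvd_quadraticNorm (a : ℕ) {z : QuadraticAlgebra O (-d.sqrtFive) 0}
    (h : (2 ^ a) ^ 2 ∣ z.norm) : 2 ^ a ∣ z := by
  have := d.isDomain
  induction a generalizing z with
  | zero => simp
  | succ a ih =>
    have h4 : (2 ^ (a + 1)) ^ 2 = (2 ^ 2 * (2 ^ a) ^ 2 : O) := by ring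
    rw [h4] at h
    obtain ⟨z', rfl⟩ := two_dvd_of_four_dvd_quadraticNorm
      (((by norm_num : (4 : O) = 2 ^ 2).dvd.mul_right _).trans h)
    rw [map_mul, quadraticNorm_two] at h
    rw [pow_succ']
    exact mul_dvd_mul_left 2 (ih ((mul_dvd_mul_iff_left (pow_ne_zero 2 d.prime_two.ne_zero)).1 h))

/-- The bound on `a` is what allows the power of `2` to be removed after adjoining `√-1`. -/
lemma exists_sq_add_sq_eq_two_pow_mul {l c e x y : O} (hl : Prime l)
    (h1 : l = c ^ 2 - d.sqrtFive * e ^ 2) (h2 : l = x ^ 2 + y ^ 2) :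
    ∃ (j k m : QuadraticAlgebra O (-d.sqrtFive) 0) (a : ℕ), a ≤ 2 ∧
      j ^ 2 + k ^ 2 = 2 ^ a * m ∧ Associated m.norm l := by
  have := d.isDomain
  have := d.isPrincipalIdealRing
  have h0 (z : QuadraticAlgebra O (-d.sqrtFive) 0) (hz : z.norm = 0) : z = 0 :=
    eq_zero_of_quadraticNorm_eq_zero d.φ_injective (by simp [d.φ_sqrtFive]) hz
  have := isDomain_quadraticAlgebra h0
  have := d.conj.isPrincipalIdealRing_quadraticAlgebra h0
    (d.conj_sqrtFive ▸ d.conj.reducible_sqrtFive)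
  wlog hcx : c + x ≠ 0 generalizing x
  · refine this (x := -x) (by rw [h2]; ring) fun hcx' ↦ hl.irreducible.not_isSquare ⟨y, ?_⟩
    obtain rfl : x = 0 := by
      refine (mul_eq_zero.1 (?_ : 2 * x = 0)).resolve_left d.prime_two.ne_zero
      linear_combination not_not.1 hcx - hcx'
    rw [h2]; ring
  obtain ⟨j, k, v, hv, hnorm⟩ := exists_norm_sq_add_sq_eq (D := -d.sqrtFive) (z := ⟨y, e⟩) hl
    (by rw [h1]; ring) h2 hcx
  obtain ⟨a, ha, η, hη⟩ := (dvd_prime_pow d.prime_two 2).1 hv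
  have hnormη : (2 ^ a) ^ 2 * l = (j ^ 2 + k ^ 2).norm * (η : O) ^ 2 := by
    rw [hnorm, ← hη]
    ring
  obtain ⟨m, hm⟩ := two_pow_dvd_of_sq_dvd_quadraticNorm a
    ((η.isUnit.pow 2).dvd_mul_right.1 ⟨l, hnormη.symm⟩)
  refine ⟨j, k, m, a, ha, hm, η ^ 2, ?_⟩
  rw [hm, map_mul, map_pow, quadraticNorm_two, pow_right_comm, mul_assoc] at hnormη
  rw [Units.val_pow_eq_pow_val]
  exact (mul_left_cancel₀ (pow_ne_zero a (pow_ne_zero 2 d.prime_two.ne_zero)) hnormη).symm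

end GoldenData

/-! ### The ring of integers of `F₀` -/

section RingOfIntegers

open Polynomial

lemma minpoly_eps : minpoly ℚ (eps zeta) = X ^ 2 + X - 1 := by
  have hdeg : (X ^ 2 + X - 1 : ℚ[X]).natDegree = 2 := by compute_degree!
  have hmonic : (X ^ 2 + X - 1 : ℚ[X]).Monic := by monicity!
  refine (minpoly.eq_of_irreducible_of_monic ?_ ?_ hmonic).symm
  · rw [hmonic.irreducible_iff_roots_eq_zero_of_degree_le_three hdeg.ge (by rw [hdeg]; simp)]
    refine Multiset.eq_zero_of_forall_notMem fun a ha ↦ ?_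
    have hroot := isRoot_of_mem_roots ha
    simp only [IsRoot.def, eval_sub, eval_add, eval_pow, eval_X, eval_one] at hroot
    have hirr : Irrational (√(5 : ℕ)) := Nat.Prime.irrational_sqrt (by norm_num)
    refine hirr ⟨|2 * a + 1|, ?_⟩
    rw [Rat.cast_abs, ← Real.sqrt_sq_eq_abs]
    congr 1
    have hsq : ((2 * a + 1) ^ 2 : ℚ) = 5 := by linear_combination 4 * hroot
    exact_mod_cast hsq
  · have hroot := congrArg (algebraMap F₀ F) eps₀_sq
    rw [map_sub, map_add, map_pow, map_one, map_zero] at hroot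
    simpa [eps, ← coe_eps₀] using hroot

lemma exists_algHom_real {x : ℝ} (hx : x ^ 2 + x - 1 = 0) : ∃ f : F₀ →ₐ[ℚ] ℝ, f eps₀ = x := by
  refine ⟨(IntermediateField.algHomAdjoinIntegralEquiv ℚ (Algebra.IsIntegral.isIntegral _)).symm
    ⟨x, ?_⟩, IntermediateField.algHomAdjoinIntegralEquiv_symm_apply_gen ℚ _ _⟩
  have h := minpoly_eps
  rw [eps] at h
  rw [mem_aroots, h]
  refine ⟨fun h0 ↦ ?_, by simpa using hx⟩
  have := congrArg (coeff · 2) h0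
  simp [coeff_X, coeff_one] at this

lemma u_eq_eps₀_add_one : u = eps₀ + 1 := by unfold u sqrt5; ring

lemma u_sq : u ^ 2 = u + 1 := by rw [u_eq_eps₀_add_one]; linear_combination eps₀_sq

lemma exists_algHom_u_eq_goldenRatio : ∃ f : F₀ →ₐ[ℚ] ℝ, f u = goldenRatio := by
  obtain ⟨f, hf⟩ := exists_algHom_real (x := goldenRatio - 1)
    (by linear_combination Real.goldenRatio_sq)
  exact ⟨f, by rw [u_eq_eps₀_add_one, map_add, map_one, hf, sub_add_cancel]⟩

lemma exists_algHom_u_eq_goldenConj : ∃ f : F₀ →ₐ[ℚ] ℝ, f u = goldenConj := by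
  obtain ⟨f, hf⟩ := exists_algHom_real (x := goldenConj - 1)
    (by linear_combination Real.goldenConj_sq)
  exact ⟨f, by rw [u_eq_eps₀_add_one, map_add, map_one, hf, sub_add_cancel]⟩

lemma exists_eq_ratCast_add_mul_u (x : F₀) : ∃ p q : ℚ, x = p + q * u := by
  let pb := IntermediateField.adjoin.powerBasis (K := ℚ) (x := zeta + zeta⁻¹)
    (Algebra.IsIntegral.isIntegral _)
  obtain ⟨f, hf, rfl⟩ := pb.exists_eq_aeval x
  have hdim : pb.dim = 2 := by
    rw [IntermediateField.adjoin.powerBasis_dim, ← eps, minpoly_eps]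
    compute_degree!
  have hgen : pb.gen = eps₀ := rfl
  obtain ⟨a, b, rfl⟩ := exists_eq_X_add_C_of_natDegree_le_one (by omega : f.natDegree ≤ 1)
  refine ⟨b - a, a, ?_⟩
  simp only [map_add, map_mul, aeval_X, aeval_C, eq_ratCast, hgen, u_eq_eps₀_add_one]
  push_cast
  ring

lemma exists_intCast_eq_of_isIntegral {p : ℚ} (h : IsIntegral ℤ (p : ℝ)) : ∃ n : ℤ, n = p :=
  IsIntegrallyClosed.isIntegral_iff.1
    ((isIntegral_algebraMap_iff (algebraMap ℚ ℝ).injective).1 (by simpa using h))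

lemma exists_intCast_eq_of_trace_of_norm {p q : ℚ} {s t : ℤ} (hs : s = 2 * p + q)
    (ht : t = p ^ 2 + p * q - q ^ 2) : ∃ m n : ℤ, p = m ∧ q = n := by
  obtain ⟨n, rfl⟩ := exists_algebraMap_eq_of_prime_mul_sq (R := ℤ) (l := 5) (T := s ^ 2 - 4 * t)
    (b := q) (by norm_num) (by
      simp only [algebraMap_int_eq, eq_intCast]
      push_cast
      rw [hs, ht]
      ring)
  simp only [algebraMap_int_eq, eq_intCast] at hs ht ⊢
  have hst : s ^ 2 - n ^ 2 = 2 * (2 * (n ^ 2 + t)) := by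
    have : ((s ^ 2 - n ^ 2 : ℤ) : ℚ) = (2 * (2 * (n ^ 2 + t)) : ℤ) := by
      push_cast; rw [hs, ht]; ring
    exact_mod_cast this
  obtain ⟨m, hm⟩ := two_dvd_sub_of_two_dvd_sq_sub_sq Int.prime_two ⟨_, hst⟩
  refine ⟨m, n, ?_, rfl⟩
  have : (s : ℚ) - n = 2 * m := by exact_mod_cast hm
  linarith

lemma exists_eq_intCast_add_mul_u {x : F₀} (hx : IsIntegral ℤ x) :
    ∃ m n : ℤ, x = m + n * u := by
  obtain ⟨p, q, rfl⟩ := exists_eq_ratCast_add_mul_u x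
  obtain ⟨f, hf⟩ := exists_algHom_u_eq_goldenRatio
  obtain ⟨g, hg⟩ := exists_algHom_u_eq_goldenConj
  have h1 : IsIntegral ℤ (f (p + q * u)) := hx.map (f.restrictScalars ℤ)
  have h2 : IsIntegral ℤ (g (p + q * u)) := hx.map (g.restrictScalars ℤ)
  simp only [map_add, map_mul, map_ratCast, hf] at h1
  simp only [map_add, map_mul, map_ratCast, hg] at h2
  obtain ⟨s, hs⟩ := exists_intCast_eq_of_isIntegral (p := 2 * p + q) (by
    convert! h1.add h2 using 1
    push_cast
    linear_combination (-q : ℝ) * Real.goldenRatio_add_goldenConj)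
  obtain ⟨t, ht⟩ := exists_intCast_eq_of_isIntegral (p := p ^ 2 + p * q - q ^ 2) (by
    convert! h1.mul h2 using 1
    push_cast
    linear_combination (-p * q : ℝ) * Real.goldenRatio_add_goldenConj -
      (q ^ 2 : ℝ) * Real.goldenRatio_mul_goldenConj)
  obtain ⟨m, n, rfl, rfl⟩ := exists_intCast_eq_of_trace_of_norm hs ht
  exact ⟨m, n, by simp⟩

end RingOfIntegers

/-- The ring of integers of `F₀` with the generator `u`. -/
def goldenF₀ : GoldenData (𝓞 F₀) where
  w := uInt
  w_sq := RingOfIntegers.ext (by simpa [coe_uInt] using u_sq)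
  span x := by
    obtain ⟨m, n, h⟩ := exists_eq_intCast_add_mul_u x.isIntegral_coe
    exact ⟨m, n, RingOfIntegers.ext (by simpa [coe_uInt] using h)⟩
  φ := exists_algHom_u_eq_goldenRatio.choose.toRingHom.comp (algebraMap (𝓞 F₀) F₀)
  ψ := exists_algHom_u_eq_goldenConj.choose.toRingHom.comp (algebraMap (𝓞 F₀) F₀)
  φ_w := exists_algHom_u_eq_goldenRatio.choose_spec
  ψ_w := exists_algHom_u_eq_goldenConj.choose_spec

lemma goldenF₀_sqrtFive : goldenF₀.sqrtFive = sqrt5Int := rfl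

lemma goldenF₀_conj_w : goldenF₀.conj.w = uConjInt := rfl

/-! ### Representability in integral coordinates -/

lemma complexConj_eq_inv {K : Type*} [Field K] [CharZero K] [IsCMField K]
    [Algebra.IsIntegral ℚ K] {z : K} {n : ℕ} (hn : n ≠ 0) (hz : z ^ n = 1) :
    IsCMField.complexConj K z = z⁻¹ := by
  obtain ⟨f⟩ : Nonempty (K →+* ℂ) := inferInstance
  apply f.injective
  rw [IsCMField.complexEmbedding_complexConj, map_inv₀]
  refine (Complex.inv_eq_conj (Complex.norm_eq_one_of_pow_eq_one (n := n) ?_ hn)).symm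
  rw [← map_pow, hz, map_one]

lemma complexConj_coe (x : F₀) : IsCMField.complexConj F (x : F) = x := by
  obtain ⟨p, q, rfl⟩ := exists_eq_ratCast_add_mul_u x
  have hu : (u : F) = zeta + zeta⁻¹ + 1 :=
    (congrArg (algebraMap F₀ F) u_eq_eps₀_add_one).trans (congrArg (· + 1) coe_eps₀)
  have hcoe : ((p + q * u : F₀) : F) = p + q * (u : F) := by simp
  rw [hcoe, hu]
  simp only [map_add, map_mul, map_ratCast, map_one, map_inv₀,
    complexConj_eq_inv (by norm_num : 5 ≠ 0) zeta_pow_five, inv_inv]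
  ring

lemma complexConj_alpha {z : F} (hz : z ^ 5 = 1) :
    IsCMField.complexConj F (alpha z) = -alpha z := by
  rw [alpha, map_sub, map_inv₀, complexConj_eq_inv (by norm_num : 5 ≠ 0) hz, inv_inv, neg_sub]

lemma isIntegral_alpha {z : F} (hz : z ^ 5 = 1) : IsIntegral ℤ (alpha z) := by
  have hint {y : F} (hy : y ^ 5 = 1) : IsIntegral ℤ y :=
    IsIntegral.of_pow (n := 5) (by norm_num) (hy ▸ isIntegral_one)
  exact (hint hz).sub (hint (by rw [inv_pow, hz, inv_one]))

lemma isIntegral_coe_iff {x : F₀} : IsIntegral ℤ (x : F) ↔ IsIntegral ℤ x :=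
  isIntegral_algebraMap_iff (A := F₀) (B := F) (algebraMap F₀ F).injective

namespace GoldenData

variable {d : GoldenData (𝓞 F₀)}

variable (d) in
/-- The form `q` built from the root `w` of `X² - X - 1` in place of `u`; it is `q` for `w = u` and
the conjugate form for `w = u^τ`. -/
def quadForm (x y : F₀) : F₀ :=
  3 * x ^ 2 + 2 * d.sqrtFive * d.w ^ 2 * x * y + d.sqrtFive * d.w * y ^ 2

variable (d) in
lemma coe_w_sq : (d.w : F₀) ^ 2 = d.w + 1 := by
  simpa using congrArg (algebraMap (𝓞 F₀) F₀) d.w_sq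

variable (d) in
lemma coe_sqrtFive_eq : (d.sqrtFive : F₀) = 2 * d.w - 1 := by
  simp only [sqrtFive, map_sub, map_mul, map_ofNat, map_one]

variable (d) in
lemma quadForm_eq (x y : F₀) :
    d.quadForm x y = d.w * (d.sqrtFive * (y + d.w * x) ^ 2 - (2 * x) ^ 2) := by
  rw [quadForm, coe_sqrtFive_eq]
  linear_combination (-2 * (d.w : F₀) ^ 2 - d.w - 3) * x ^ 2 * d.coe_w_sq

variable (d) in
lemma exists_quadForm_eq (a b : 𝓞 F₀) :
    ∃ x y : F₀, d.quadForm x y = (d.w * (d.sqrtFive * b ^ 2 - a ^ 2) : 𝓞 F₀) ∧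
      a = 2 * x ∧ b = y + d.w * x := by
  have ha : 2 * (a / 2 : F₀) = a := mul_div_cancel₀ _ two_ne_zero
  refine ⟨a / 2, b - d.w * (a / 2), ?_, ha.symm, (sub_add_cancel _ _).symm⟩
  rw [quadForm_eq, sub_add_cancel, ha]
  simp only [map_mul, map_sub, map_pow]

section Matrices

open Matrix

variable {z : F}

lemma eps_mul_w (h : (eps z)⁻¹ = d.w) : eps z * d.w = 1 := by
  have hw : (d.w : F) ≠ 0 :=
    (d.isUnit_w.map ((algebraMap F₀ F).comp (algebraMap (𝓞 F₀) F₀))).ne_zero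
  rw [← h] at hw ⊢
  exact mul_inv_cancel₀ (mt inv_eq_zero.2 hw)

lemma smul_gammaQ_add_smul_gammaP (hz : eps z * d.w = 1) (x y : F₀) :
    (x : F) • gammaQ z + (y : F) • gammaP z =
      !![-(alpha z * ((y + d.w * x : F₀) : F)), ((2 * x : F₀) : F);
        (d.w : F) * ((2 * x : F₀) : F), alpha z * ((y + d.w * x : F₀) : F)] := by
  have hinv : (eps z)⁻¹ = d.w := inv_eq_of_mul_eq_one_right hz
  ext i j
  fin_cases i <;> fin_cases j <;> simp [gammaQ, gammaP, div_eq_mul_inv, hinv, coe_two] <;> ring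

lemma alpha_sq_eq_neg_sqrtFive_mul_w (hz0 : z ≠ 0) (hz : eps z * d.w = 1) :
    alpha z ^ 2 = -((d.sqrtFive * d.w : F₀) : F) := by
  have hw : (d.w : F) ^ 2 = d.w + 1 := congrArg (algebraMap F₀ F) d.coe_w_sq
  have hr : ((d.sqrtFive * d.w : F₀) : F) = (2 * d.w - 1) * d.w := by
    rw [coe_sqrtFive_eq]; rfl
  have heps : eps z = d.w - 1 := by linear_combination (d.w - 1 : F) * hz - eps z * hw
  have halpha : alpha z ^ 2 = eps z ^ 2 - 4 := by
    rw [alpha, eps]; linear_combination (-4 : F) * mul_inv_cancel₀ hz0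
  rw [halpha, hr, heps]
  linear_combination 3 * hw

lemma det_smul_gammaQ_add_smul_gammaP (hz0 : z ≠ 0) (hz : eps z * d.w = 1) (x y : F₀) :
    ((x : F) • gammaQ z + (y : F) • gammaP z).det = (d.quadForm x y : F₀) := by
  rw [smul_gammaQ_add_smul_gammaP hz, det_fin_two_of, quadForm_eq]
  have halpha := alpha_sq_eq_neg_sqrtFive_mul_w hz0 hz
  push_cast at halpha ⊢
  linear_combination (-((y : F) + d.w * x) ^ 2) * halpha

lemma conjTr_mul_hermGram_mul (hz5 : z ^ 5 = 1) (hz : eps z * d.w = 1) (x y : F₀) :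
    conjTr ((x : F) • gammaQ z + (y : F) • gammaP z) * hermGram z *
      ((x : F) • gammaQ z + (y : F) • gammaP z) =
    ((x : F) • gammaQ z + (y : F) • gammaP z).det • hermGram z := by
  rw [smul_gammaQ_add_smul_gammaP hz]
  generalize y + d.w * x = a, 2 * x = b
  have ha := complexConj_alpha hz5
  ext i j
  fin_cases i <;> fin_cases j <;>
    simp [conjTr, hermGram, det_fin_two, Matrix.mul_apply, Fin.sum_univ_two, complexConj_coe, ha]
  · linear_combination (-(d.w : F) * b ^ 2) * hz
  · linear_combination (-alpha z * a * b) * hz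
  · linear_combination (alpha z * a * b) * hz
  · linear_combination (-(b : F) ^ 2) * hz

lemma mem_GU₂_of_isIntegral (hz5 : z ^ 5 = 1) (hz : eps z * d.w = 1) {x y : F₀}
    (hx : IsIntegral ℤ (2 * x)) (hy : IsIntegral ℤ (y + d.w * x)) (h0 : d.quadForm x y ≠ 0) :
    (x : F) • gammaQ z + (y : F) • gammaP z ∈ GU₂ z := by
  have hz0 : z ≠ 0 := by rintro rfl; norm_num at hz5
  have hdet := det_smul_gammaQ_add_smul_gammaP hz0 hz x y
  refine ⟨?_, ⟨d.quadForm x y, h0, ?_⟩, ?_⟩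
  · rw [hdet]
    exact (map_ne_zero_iff _ (algebraMap F₀ F).injective).2 h0
  · rw [← hdet, conjTr_mul_hermGram_mul hz5 hz]
  · rw [smul_gammaQ_add_smul_gammaP hz]
    have ha := isIntegral_alpha hz5
    rw [← isIntegral_coe_iff] at hx hy
    intro i j
    fin_cases i <;> fin_cases j
    · exact (ha.mul hy).neg
    · exact hx
    · exact (isIntegral_coe_iff.2 d.w.isIntegral_coe).mul hx
    · exact ha.mul hy

/-- The diagonal entry `α (y + w x)` has square `-√5 w (y + w x)²`, and `√5` is prime. -/
lemma exists_coe_eq_of_mem_GU₂ (hz0 : z ≠ 0) (hz : eps z * d.w = 1) {x y : F₀}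
    (h : (x : F) • gammaQ z + (y : F) • gammaP z ∈ GU₂ z) :
    ∃ a b : 𝓞 F₀, a = 2 * x ∧ b = y + d.w * x := by
  obtain ⟨-, -, h⟩ := h
  rw [smul_gammaQ_add_smul_gammaP hz] at h
  have hsq : IsIntegral ℤ (-(d.sqrtFive * d.w : F₀) * (y + d.w * x) ^ 2) := by
    rw [← isIntegral_coe_iff]
    have h11 : IsIntegral ℤ ((alpha z * ((y + d.w * x : F₀) : F)) ^ 2) := (h 1 1).pow 2
    rwa [mul_pow, alpha_sq_eq_neg_sqrtFive_mul_w hz0 hz] at h11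
  obtain ⟨T, hT⟩ : ∃ T : 𝓞 F₀, T = -(d.sqrtFive * d.w : F₀) * (y + d.w * x) ^ 2 := ⟨⟨_, hsq⟩, rfl⟩
  obtain ⟨b, hb⟩ := exists_algebraMap_eq_of_prime_mul_sq (T := T * (1 - d.w)) (b := y + d.w * x)
    d.prime_sqrtFive (by
      simp only [map_mul, map_sub, map_one, hT]
      linear_combination (-(d.sqrtFive : F₀) * (y + d.w * x) ^ 2) * d.coe_w_sq)
  exact ⟨⟨_, isIntegral_coe_iff.1 (h 0 1)⟩, b, rfl, hb⟩

lemma exists_mem_GU₂_iff_rep (hz5 : z ^ 5 = 1) (hz : eps z * d.w = 1) {lam : 𝓞 F₀}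
    (h0 : lam ≠ 0) :
    (∃ x y : F₀, d.quadForm x y = lam ∧ (x : F) • gammaQ z + (y : F) • gammaP z ∈ GU₂ z) ↔
      d.Rep lam := by
  have hz0 : z ≠ 0 := by rintro rfl; norm_num at hz5
  constructor
  · rintro ⟨x, y, hq, h⟩
    obtain ⟨a, b, ha, hb⟩ := exists_coe_eq_of_mem_GU₂ hz0 hz h
    refine ⟨a, b, RingOfIntegers.ext ?_⟩
    simp only [map_mul, map_sub, map_pow, ha, hb]
    rw [← hq, quadForm_eq]
  · rintro ⟨a, b, h⟩
    obtain ⟨x, y, hq, ha, hb⟩ := d.exists_quadForm_eq a b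
    rw [← h] at hq
    refine ⟨x, y, hq, mem_GU₂_of_isIntegral hz5 hz (ha ▸ a.isIntegral_coe)
      (hb ▸ b.isIntegral_coe) ?_⟩
    rw [hq]
    exact (map_ne_zero_iff _ RingOfIntegers.coe_injective).2 h0

end Matrices

lemma Rep.exists_quadForm_eq {lam : 𝓞 F₀} (h : d.Rep lam) (h4 : 4 ∣ lam + 1) :
    ∃ x y : F₀, d.quadForm x y = lam ∧
      ∃ x₁ d₁ : 𝓞 F₀, x₁ = 2 * x ∧ d₁ = y + d.w * x ∧ 2 ∣ x₁ ∧ 2 ∣ d₁ - d.w := by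
  obtain ⟨a, b, rfl, ha, hb⟩ := h.exists_two_dvd h4
  obtain ⟨x, y, hq, hx, hy⟩ := d.exists_quadForm_eq a b
  exact ⟨x, y, hq, a, b, hx, hy, ha, hb⟩

end GoldenData

lemma q_eq_quadForm : q = goldenF₀.quadForm := by
  funext x y
  rw [q, GoldenData.quadForm, goldenF₀_sqrtFive, coe_sqrt5Int]
  rfl

lemma qConj_eq_quadForm : qConj = goldenF₀.conj.quadForm := by
  funext x y
  simp only [qConj, GoldenData.quadForm, GoldenData.conj_sqrtFive, goldenF₀_sqrtFive,
    goldenF₀_conj_w, map_neg, coe_sqrt5Int, coe_uConjInt]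

lemma representable_iff {lam : 𝓞 F₀} (h0 : lam ≠ 0) :
    Representable lam ↔ goldenF₀.Rep lam := by
  rw [Representable, q_eq_quadForm]
  exact GoldenData.exists_mem_GU₂_iff_rep zeta_pow_five
    (GoldenData.eps_mul_w (d := goldenF₀) eps_inv) h0

lemma representableConj_iff {lam : 𝓞 F₀} (h0 : lam ≠ 0) :
    RepresentableConj lam ↔ goldenF₀.conj.Rep lam := by
  rw [RepresentableConj, qConj_eq_quadForm]
  refine GoldenData.exists_mem_GU₂_iff_rep ?_ (GoldenData.eps_mul_w ?_) h0
  · rw [← pow_mul, mul_comm, pow_mul, zeta_pow_five, one_pow]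
  · rw [goldenF₀_conj_w, coe_uConjInt]
    exact eps_sq_inv

/-! ### Biquadratic extensions `K(√-1, √r)` -/

section Galois

variable {K L : Type*} [Field K] [Field L] [Algebra K L]

lemma coe_gal_smul (g : Gal(L/K)) (x : 𝓞 L) : ((g • x : 𝓞 L) : L) = g x :=
  algebraMap.coe_smul' g x L

lemma gal_smul_algebraMap (g : Gal(L/K)) (a : 𝓞 K) :
    g • algebraMap (𝓞 K) (𝓞 L) a = algebraMap (𝓞 K) (𝓞 L) a := by
  apply RingOfIntegers.coe_injective
  rw [← RingOfIntegers.coe_eq_algebraMap, coe_gal_smul, RingOfIntegers.coe_eq_algebraMap,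
    ← IsScalarTower.algebraMap_apply, IsScalarTower.algebraMap_apply (𝓞 K) K L,
    AlgEquiv.commutes]

open ComplexConjugate

lemma exists_gal_smul_eq_conj [NumberField K] [IsGalois K L] {φ : 𝓞 K →+* ℝ}
    (hφ : Function.Injective φ) :
    ∃ (Φ : 𝓞 L →+* ℂ) (g : Gal(L/K)), Function.Injective Φ ∧
      (∀ a, Φ (algebraMap (𝓞 K) (𝓞 L) a) = (φ a : ℂ)) ∧ ∀ x, Φ (g • x) = conj (Φ x) := by
  let φK : K →+* ℝ := IsFractionRing.lift hφ
  let Φ : L →+* ℂ := ComplexEmbedding.lift L (Complex.ofRealHom.comp φK)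
  have hΦ (a : K) : Φ (algebraMap K L a) = (φK a : ℂ) :=
    RingHom.congr_fun (ComplexEmbedding.lift_comp_algebraMap L (Complex.ofRealHom.comp φK)) a
  obtain ⟨g, hg⟩ := ComplexEmbedding.exists_comp_symm_eq_of_comp_eq (k := K) Φ
    ((starRingEnd ℂ).comp Φ) (by ext a; simp [hΦ])
  refine ⟨Φ.comp (algebraMap (𝓞 L) L), g.symm, Φ.injective.comp RingOfIntegers.coe_injective,
    fun a ↦ ?_, fun x ↦ ?_⟩
  · exact (hΦ a).trans (congrArg _ (IsFractionRing.lift_algebraMap hφ a))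
  · exact (congrArg Φ (coe_gal_smul g.symm x)).trans (RingHom.congr_fun hg x)

lemma conj_eq_of_sq_eq {z : ℂ} {c : ℝ} (hc : 0 < c) (h : z ^ 2 = c) : conj z = z := by
  rw [← Real.sq_sqrt hc.le, Complex.ofReal_pow, sq_eq_sq_iff_eq_or_eq_neg] at h
  rcases h with rfl | rfl <;> simp

lemma conj_eq_neg_of_sq_eq {z : ℂ} {c : ℝ} (hc : c < 0) (h : z ^ 2 = c) : conj z = -z := by
  have hI := conj_eq_of_sq_eq (z := z * Complex.I) (neg_pos.2 hc) (by
    rw [mul_pow, h, Complex.I_sq]; simp)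
  rw [map_mul, Complex.conj_I] at hI
  exact mul_right_cancel₀ Complex.I_ne_zero (by linear_combination -hI)

lemma gal_smul_eq_neg_of_sq_eq_neg_one {Φ : 𝓞 L →+* ℂ} {g : Gal(L/K)}
    (hΦ : Function.Injective Φ) (hg : ∀ x, Φ (g • x) = conj (Φ x)) {i : 𝓞 L} (hi : i ^ 2 = -1) :
    g • i = -i := hΦ <| by
  rw [hg, map_neg, conj_eq_neg_of_sq_eq (c := -1) (by norm_num) (by rw [← map_pow, hi]; simp)]

end Galois

/-- The biquadratic extension `L = K(√-1, √r)`, presented by integral generators and by generators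
of its Galois group. -/
structure BiquadraticData {K : Type*} [Field K] (r : 𝓞 K) (L : Type*) [Field L] [Algebra K L] where
  /-- a square root of `-1` -/
  i : 𝓞 L
  /-- a square root of `r` -/
  θ : 𝓞 L
  i_sq : i ^ 2 = -1
  θ_sq : θ ^ 2 = algebraMap (𝓞 K) (𝓞 L) r
  θ_ne_zero : θ ≠ 0
  /-- the automorphism that only moves `i` -/
  σ : Gal(L/K)
  /-- the automorphism that only moves `θ` -/
  τ : Gal(L/K)
  σ_i : σ • i = -i
  σ_θ : σ • θ = θ
  τ_i : τ • i = i
  τ_θ : τ • θ = -θ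
  eq_one : ∀ g : Gal(L/K), g • i = i → g • θ = θ → g = 1

/-- Opposite signs of `r` at two real places make the two complex conjugations differ on `√r`, so
that they generate the Galois group. -/
lemma nonempty_biquadraticData {K L : Type*} [Field K] [NumberField K] [Field L] [Algebra K L]
    [IsGalois K L] {φ ψ : 𝓞 K →+* ℝ} (hφ : Function.Injective φ) (hψ : Function.Injective ψ)
    {r : 𝓞 K} (hφr : 0 < φ r) (hψr : ψ r < 0) {i θ : 𝓞 L} (hi : i ^ 2 = -1)
    (hθ : θ ^ 2 = algebraMap (𝓞 K) (𝓞 L) r)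
    (heq_one : ∀ g : Gal(L/K), g • i = i → g • θ = θ → g = 1) :
    Nonempty (BiquadraticData r L) := by
  obtain ⟨Φ, σ, hΦ, hΦr, hσ⟩ := exists_gal_smul_eq_conj (L := L) hφ
  obtain ⟨Ψ, σ', hΨ, hΨr, hσ'⟩ := exists_gal_smul_eq_conj (L := L) hψ
  have hσi : σ • i = -i := gal_smul_eq_neg_of_sq_eq_neg_one hΦ hσ hi
  have hσi' : σ' • i = -i := gal_smul_eq_neg_of_sq_eq_neg_one hΨ hσ' hi
  have hσθ : σ • θ = θ := hΦ <| by
    rw [hσ, conj_eq_of_sq_eq hφr (by rw [← map_pow, hθ, hΦr])]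
  have hσθ' : σ' • θ = -θ := hΨ <| by
    rw [hσ', map_neg, conj_eq_neg_of_sq_eq hψr (by rw [← map_pow, hθ, hΨr])]
  have hθ0 : θ ≠ 0 := by
    rintro rfl
    have hr := hΦr r
    rw [← hθ, zero_pow two_ne_zero, map_zero, eq_comm, Complex.ofReal_eq_zero] at hr
    exact hφr.ne' hr
  refine ⟨⟨i, θ, hi, hθ, hθ0, σ, σ * σ', hσi, hσθ, ?_, ?_, heq_one⟩⟩
  · rw [mul_smul, hσi', smul_neg, hσi, neg_neg]
  · rw [mul_smul, hσθ', smul_neg, hσθ]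

namespace BiquadraticData

variable {K L : Type*} [Field K] [Field L] [Algebra K L] {r : 𝓞 K} (D : BiquadraticData r L)

lemma i_ne_zero : D.i ≠ 0 := fun h ↦ by simpa [h] using D.i_sq

lemma isUnit_i : IsUnit D.i := .of_mul_eq_one (-D.i) (by linear_combination -D.i_sq)

/-- The same extension, generated by `√-1` and `√-r`. -/
def conj : BiquadraticData (-r) L where
  i := D.i
  θ := D.i * D.θ
  i_sq := D.i_sq
  θ_sq := by rw [mul_pow, D.i_sq, D.θ_sq, map_neg, neg_one_mul]
  θ_ne_zero := mul_ne_zero D.i_ne_zero D.θ_ne_zero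
  σ := D.σ * D.τ
  τ := D.τ
  σ_i := by rw [mul_smul, D.τ_i, D.σ_i]
  σ_θ := by rw [mul_smul, smul_mul', D.τ_i, D.τ_θ, smul_mul', smul_neg, D.σ_i, D.σ_θ, neg_mul_neg]
  τ_i := D.τ_i
  τ_θ := by rw [smul_mul', D.τ_i, D.τ_θ, mul_neg]
  eq_one g hi hθ := by
    refine D.eq_one g hi (mul_left_cancel₀ D.i_ne_zero ?_)
    rwa [smul_mul', hi] at hθ

lemma smul_i (g : Gal(L/K)) : g • D.i = D.i ∨ g • D.i = -D.i := by
  rw [← sq_eq_sq_iff_eq_or_eq_neg, ← smul_pow', D.i_sq, smul_neg, smul_one]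

lemma smul_θ (g : Gal(L/K)) : g • D.θ = D.θ ∨ g • D.θ = -D.θ := by
  rw [← sq_eq_sq_iff_eq_or_eq_neg, ← smul_pow', D.θ_sq, gal_smul_algebraMap]

lemma eq_of_smul {g h : Gal(L/K)} (hi : g • D.i = h • D.i) (hθ : g • D.θ = h • D.θ) : g = h :=
  (inv_mul_eq_one.1 (D.eq_one (h⁻¹ * g) (by rw [mul_smul, hi, inv_smul_smul])
    (by rw [mul_smul, hθ, inv_smul_smul]))).symm

lemma σ_mul_σ : D.σ * D.σ = 1 :=
  D.eq_one _ (by rw [mul_smul, D.σ_i, smul_neg, D.σ_i, neg_neg]) (by rw [mul_smul, D.σ_θ, D.σ_θ])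

lemma τ_mul_τ : D.τ * D.τ = 1 :=
  D.eq_one _ (by rw [mul_smul, D.τ_i, D.τ_i]) (by rw [mul_smul, D.τ_θ, smul_neg, D.τ_θ, neg_neg])

lemma τ_mul_σ : D.τ * D.σ = D.σ * D.τ :=
  D.eq_of_smul (by simp only [mul_smul, D.σ_i, D.τ_i, smul_neg])
    (by simp only [mul_smul, D.σ_θ, D.τ_θ, smul_neg])

lemma gal_cases (g : Gal(L/K)) : g = 1 ∨ g = D.τ ∨ g = D.σ ∨ g = D.σ * D.τ := by
  rcases D.smul_i g with hi | hi <;> rcases D.smul_θ g with hθ | hθ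
  · exact .inl (D.eq_one g hi hθ)
  · exact .inr (.inl (D.eq_of_smul (by rw [hi, D.τ_i]) (by rw [hθ, D.τ_θ])))
  · exact .inr (.inr (.inl (D.eq_of_smul (by rw [hi, D.σ_i]) (by rw [hθ, D.σ_θ]))))
  · exact .inr (.inr (.inr (D.eq_of_smul (by rw [hi, mul_smul, D.τ_i, D.σ_i])
      (by rw [hθ, mul_smul, D.τ_θ, smul_neg, D.σ_θ]))))

variable [NumberField K] [NumberField L] [IsGalois K L]

lemma exists_algebraMap_eq {x : 𝓞 L} (hσ : D.σ • x = x) (hτ : D.τ • x = x) :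
    ∃ a, algebraMap (𝓞 K) (𝓞 L) a = x := by
  refine Algebra.IsInvariant.isInvariant (G := Gal(L/K)) x fun g ↦ ?_
  rcases D.gal_cases g with rfl | rfl | rfl | rfl
  · exact one_smul _ x
  · exact hτ
  · exact hσ
  · rw [mul_smul, hτ, hσ]

lemma algebraMap_intNorm (x : 𝓞 L) :
    algebraMap (𝓞 K) (𝓞 L) (Algebra.intNorm (𝓞 K) (𝓞 L) x) =
      x * D.σ • x * D.τ • (x * D.σ • x) := by
  classical
  have hτ : D.τ ≠ 1 := fun h ↦ self_ne_neg.2 D.θ_ne_zero (by rw [← D.τ_θ, h, one_smul])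
  have hi (g h : Gal(L/K)) (hg : g • D.i = -D.i) (hh : h • D.i = D.i) : g ≠ h := by
    rintro rfl
    exact self_ne_neg.2 D.i_ne_zero (hh.symm.trans hg)
  have hστ : (D.σ * D.τ) • D.i = -D.i := by rw [mul_smul, D.τ_i, D.σ_i]
  have huniv : (Finset.univ : Finset Gal(L/K)) = {1, D.τ, D.σ, D.σ * D.τ} :=
    (Finset.eq_univ_of_forall fun g ↦ by simpa using D.gal_cases g).symm
  apply RingOfIntegers.coe_injective
  rw [← IsScalarTower.algebraMap_apply, IsScalarTower.algebraMap_apply (𝓞 K) K L,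
    Algebra.algebraMap_intNorm (A := 𝓞 K) (K := K) (L := L) (B := 𝓞 L),
    Algebra.norm_eq_prod_automorphisms, huniv,
    Finset.prod_insert (by simp [hτ.symm, (hi _ 1 D.σ_i (one_smul _ _)).symm,
      (hi _ 1 hστ (one_smul _ _)).symm]),
    Finset.prod_insert (by simp [(hi _ _ D.σ_i D.τ_i).symm, (hi _ _ hστ D.τ_i).symm]),
    Finset.prod_pair (by simpa using hτ), smul_mul', ← mul_smul, D.τ_mul_σ]
  simp only [map_mul, ← RingOfIntegers.coe_eq_algebraMap, coe_gal_smul, AlgEquiv.one_apply]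
  ring

include D in
lemma intNorm_nonneg {φ : 𝓞 K →+* ℝ} (hφ : Function.Injective φ) (x : 𝓞 L) :
    0 ≤ φ (Algebra.intNorm (𝓞 K) (𝓞 L) x) := by
  obtain ⟨Φ, g, hΦ, hΦφ, hg⟩ := exists_gal_smul_eq_conj (L := L) hφ
  have hgi : g • D.i = -D.i := gal_smul_eq_neg_of_sq_eq_neg_one hΦ hg D.i_sq
  wlog hσ : g = D.σ generalizing r
  · refine this D.conj hgi (?_ : g = D.σ * D.τ)
    have hθ := (D.smul_θ g).resolve_left fun hθ ↦
      hσ (D.eq_of_smul (hgi.trans D.σ_i.symm) (hθ.trans D.σ_θ.symm))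
    exact D.eq_of_smul (by rw [hgi, mul_smul, D.τ_i, D.σ_i])
      (by rw [hθ, mul_smul, D.τ_θ, smul_neg, D.σ_θ])
  have hnorm := congrArg Φ (D.algebraMap_intNorm x)
  rw [hΦφ, smul_mul', ← mul_smul, D.τ_mul_σ, mul_smul, map_mul, map_mul, map_mul, ← hσ, hg, hg,
    Complex.mul_conj, Complex.mul_conj, ← Complex.ofReal_mul, Complex.ofReal_inj] at hnorm
  rw [hnorm]
  exact mul_nonneg (Complex.normSq_nonneg _) (Complex.normSq_nonneg _)

include D in
lemma exists_four_mul_intNorm_eq (hr : Prime r) (x : 𝓞 L) :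
    ∃ a e : 𝓞 K, 4 * Algebra.intNorm (𝓞 K) (𝓞 L) x = a ^ 2 - r * e ^ 2 := by
  have hN := D.algebraMap_intNorm x
  set N := Algebra.intNorm (𝓞 K) (𝓞 L) x
  set y := x * D.σ • x with hy
  have hσy : D.σ • y = y := by
    rw [hy, smul_mul', ← mul_smul, D.σ_mul_σ, one_smul, mul_comm]
  have hστy : D.σ • D.τ • y = D.τ • y := by rw [← mul_smul, ← D.τ_mul_σ, mul_smul, hσy]
  have hττy : D.τ • D.τ • y = y := by rw [← mul_smul, D.τ_mul_τ, one_smul]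
  obtain ⟨a, ha⟩ := D.exists_algebraMap_eq (x := y + D.τ • y) (by rw [smul_add, hσy, hστy])
    (by rw [smul_add, hττy, add_comm])
  obtain ⟨e, he⟩ := D.exists_algebraMap_eq (x := D.θ * (y - D.τ • y))
    (by rw [smul_mul', D.σ_θ, smul_sub, hσy, hστy])
    (by rw [smul_mul', D.τ_θ, smul_sub, hττy]; ring)
  have he_sq : e ^ 2 = r * (a ^ 2 - 4 * N) := by
    apply FaithfulSMul.algebraMap_injective (𝓞 K) (𝓞 L)
    simp only [map_pow, map_mul, map_sub, map_ofNat, ← D.θ_sq, ha, he, hN]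
    ring
  obtain ⟨e, rfl⟩ := hr.dvd_of_dvd_pow (Dvd.intro _ he_sq.symm)
  exact ⟨a, e, mul_left_cancel₀ hr.ne_zero (by linear_combination he_sq)⟩

end BiquadraticData

/-! ### Splitting of primes -/

section Splitting

lemma isMaximal_span_singleton {R : Type*} [CommRing R] [Ring.DimensionLEOne R] {l : R}
    (h : Prime l) : (Ideal.span {l}).IsMaximal :=
  ((Ideal.span_singleton_prime h.ne_zero).2 h).isMaximal (by simpa using h.ne_zero)

lemma relNorm_eq_one_iff {R S : Type*} [CommRing R] [IsDedekindDomain R] [CommRing S]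
    [IsDedekindDomain S] [Algebra R S] [Module.Finite R S] [Module.IsTorsionFree R S]
    {I : Ideal S} : Ideal.relNorm R I = 1 ↔ I = 1 := by
  refine ⟨fun h ↦ ?_, fun h ↦ by rw [h, map_one]⟩
  have hle := Ideal.relNorm_le_comap R I
  rwa [h, Ideal.one_eq_top, top_le_iff, Ideal.comap_eq_top_iff, ← Ideal.one_eq_top] at hle

lemma mem_primesOver_of_relNorm_eq {R S : Type*} [CommRing R] [IsDedekindDomain R] [CommRing S]
    [IsDedekindDomain S] [Algebra R S] [Module.Finite R S] [Module.IsTorsionFree R S]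
    {p : Ideal R} [hp : p.IsPrime] (hp0 : p ≠ ⊥) {I : Ideal S} (h : Ideal.relNorm R I = p) :
    I ∈ p.primesOver S := by
  have hpm : p.IsMaximal := hp.isMaximal hp0
  have hirr : Irreducible (Ideal.relNorm R I) := h ▸ (Ideal.prime_of_isPrime hp0 hp).irreducible
  have hI : Prime I := by
    refine Irreducible.prime ⟨fun hu ↦ hirr.not_isUnit (hu.map _), fun A B hAB ↦ ?_⟩
    have hAB' := hirr.isUnit_or_isUnit (by rw [hAB, map_mul] : _ = _ * _)
    simpa only [Ideal.isUnit_iff, ← Ideal.one_eq_top, relNorm_eq_one_iff] using hAB'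
  have hIp := Ideal.isPrime_of_prime hI
  exact ⟨hIp, ⟨hpm.eq_of_le (Ideal.IsPrime.ne_top inferInstance)
    (h ▸ Ideal.relNorm_le_comap R I)⟩⟩

variable {K L : Type*} [Field K] [Field L] [Algebra K L]

lemma algebraMap_mem_iff_dvd {l x : 𝓞 K} {P : Ideal (𝓞 L)}
    (hP : P ∈ (Ideal.span {l}).primesOver (𝓞 L)) :
    algebraMap (𝓞 K) (𝓞 L) x ∈ P ↔ l ∣ x := by
  have := hP.2
  rw [← Ideal.mem_span_singleton, Ideal.mem_of_liesOver P (Ideal.span {l})]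

lemma exists_sub_algebraMap_mem [NumberField K] {l : 𝓞 K} (hl : Prime l) {P : Ideal (𝓞 L)}
    (hP : P ∈ (Ideal.span {l}).primesOver (𝓞 L)) (h : P.inertiaDeg (𝓞 K) = 1) (x : 𝓞 L) :
    ∃ y : 𝓞 K, x - algebraMap _ _ y ∈ P := by
  have := isMaximal_span_singleton hl
  have := hP.2
  have : P.IsMaximal := Ideal.isMaximal_of_mem_primesOver hP
  let : Field (𝓞 K ⧸ Ideal.span {l}) := Ideal.Quotient.field _
  rw [Ideal.inertiaDeg_eq_of_isMaximal (Ideal.span {l}) P] at h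
  obtain ⟨y, hy⟩ := (finrank_eq_one_iff_of_nonzero' (1 : 𝓞 L ⧸ P) one_ne_zero).1 h
    (Ideal.Quotient.mk P x)
  obtain ⟨y, rfl⟩ := Ideal.Quotient.mk_surjective y
  refine ⟨y, Ideal.Quotient.eq.1 ?_⟩
  rw [← hy, Algebra.smul_def, mul_one]
  rfl

lemma exists_dvd_sq_sub_of_inertiaDeg_eq_one [NumberField K] {l c : 𝓞 K} (hl : Prime l)
    {P : Ideal (𝓞 L)} (hP : P ∈ (Ideal.span {l}).primesOver (𝓞 L)) (h : P.inertiaDeg (𝓞 K) = 1)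
    {x : 𝓞 L} (hx : x ^ 2 = algebraMap (𝓞 K) (𝓞 L) c) : ∃ t, l ∣ t ^ 2 - c := by
  obtain ⟨t, ht⟩ := exists_sub_algebraMap_mem hl hP h x
  refine ⟨t, (algebraMap_mem_iff_dvd hP).1 ?_⟩
  convert! P.mul_mem_left (-(x + algebraMap _ _ t)) ht using 1
  rw [map_sub, map_pow, ← hx]
  ring

lemma gal_smul_sub_mem {P : Ideal (𝓞 L)} [P.IsPrime] {g : Gal(L/K)}
    (hg : g ∈ MulAction.stabilizer Gal(L/K) P) {x : 𝓞 L} {t : 𝓞 K}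
    (h : x ^ 2 - algebraMap (𝓞 K) (𝓞 L) t ^ 2 ∈ P) : g • x - x ∈ P := by
  have hgP (y : 𝓞 L) (hy : y ∈ P) : g • y ∈ P := by
    have hgy := Ideal.smul_mem_pointwise_smul g y P hy
    rwa [MulAction.mem_stabilizer_iff.1 hg] at hgy
  rw [sq_sub_sq] at h
  rcases Ideal.IsPrime.mem_or_mem inferInstance h with h | h
  · simpa only [smul_add, gal_smul_algebraMap, add_sub_add_right_eq_sub] using
      P.sub_mem (hgP _ h) h
  · simpa only [smul_sub, gal_smul_algebraMap, sub_sub_sub_cancel_right] using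
      P.sub_mem (hgP _ h) h

lemma gal_smul_eq_self {P : Ideal (𝓞 L)} [P.IsPrime] {g : Gal(L/K)}
    (hg : g ∈ MulAction.stabilizer Gal(L/K) P) {x : 𝓞 L} {t : 𝓞 K} (hx : 2 * x ∉ P)
    (h : x ^ 2 - algebraMap (𝓞 K) (𝓞 L) t ^ 2 ∈ P) (hgx : g • x = x ∨ g • x = -x) :
    g • x = x := by
  refine hgx.resolve_right fun hneg ↦ hx (neg_mem_iff.1 ?_)
  convert! gal_smul_sub_mem hg h using 1
  rw [hneg]
  ring

namespace BiquadraticData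

variable {r : 𝓞 K} (D : BiquadraticData r L)

include D in
/-- Modulo a prime above `l`, both `√-1` and `√r` are congruent to elements of `K`, so its
decomposition group is trivial. -/
lemma ramificationIdx_eq_one_and_inertiaDeg_eq_one [NumberField K] [NumberField L] [IsGalois K L]
    {l s t : 𝓞 K} (hl : Prime l)
    (h2 : ¬ l ∣ 2) (hr : ¬ l ∣ r) (hs : l ∣ s ^ 2 + 1) (ht : l ∣ t ^ 2 - r) {P : Ideal (𝓞 L)}
    (hP : P ∈ (Ideal.span {l}).primesOver (𝓞 L)) :
    P.ramificationIdx (𝓞 K) = 1 ∧ P.inertiaDeg (𝓞 K) = 1 := by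
  have := isMaximal_span_singleton hl
  have := hP.1
  have := hP.2
  have hmem (x : 𝓞 K) := algebraMap_mem_iff_dvd (x := x) hP
  have h2P : (2 : 𝓞 L) ∉ P := by rwa [← map_ofNat (algebraMap (𝓞 K) (𝓞 L)) 2, hmem]
  have hiP : 2 * D.i ∉ P := by rwa [Ideal.mul_unit_mem_iff_mem P D.isUnit_i]
  have hθP : 2 * D.θ ∉ P := fun h ↦ (Ideal.IsPrime.mem_or_mem inferInstance h).elim h2P fun h ↦
    hr <| (hmem r).1 <| D.θ_sq ▸ P.pow_mem_of_mem h 2 two_pos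
  have hs' : D.i ^ 2 - algebraMap (𝓞 K) (𝓞 L) s ^ 2 ∈ P := by
    rw [D.i_sq, ← neg_add', ← map_pow, ← map_one (algebraMap (𝓞 K) (𝓞 L)), ← map_add, neg_mem_iff,
      hmem, add_comm]
    exact hs
  have ht' : D.θ ^ 2 - algebraMap (𝓞 K) (𝓞 L) t ^ 2 ∈ P := by
    rwa [D.θ_sq, ← map_pow, ← map_sub, hmem, dvd_sub_comm]
  have hst : MulAction.stabilizer Gal(L/K) P = ⊥ := eq_bot_iff.2 fun g hg ↦
    D.eq_one g (gal_smul_eq_self hg hiP hs' (D.smul_i g)) (gal_smul_eq_self hg hθP ht' (D.smul_θ g))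
  have : Finite (𝓞 K ⧸ Ideal.span {l}) :=
    Ideal.finiteQuotientOfFreeOfNeBot _ (by simpa using hl.ne_zero)
  have hcard := Ideal.card_stabilizer_eq (G := Gal(L/K)) (Ideal.span {l}) P
  rw [hst, Subgroup.card_bot,
    Ideal.ramificationIdxIn_eq_ramificationIdx (Ideal.span {l}) P Gal(L/K),
    Ideal.inertiaDegIn_eq_inertiaDeg (Ideal.span {l}) P Gal(L/K)] at hcard
  exact ⟨Nat.eq_one_of_mul_eq_one_right hcard.symm, Nat.eq_one_of_mul_eq_one_left hcard.symm⟩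

/-! ### Norms from a biquadratic extension -/

/-- The map `a + b √r ↦ a + b θ`. -/
def ofQuadratic : QuadraticAlgebra (𝓞 K) r 0 →ₐ[𝓞 K] 𝓞 L :=
  QuadraticAlgebra.lift ⟨D.θ, by
    rw [← sq, D.θ_sq, zero_smul, add_zero, Algebra.smul_def, mul_one]⟩

lemma ofQuadratic_apply (z : QuadraticAlgebra (𝓞 K) r 0) :
    D.ofQuadratic z = algebraMap _ _ z.re + algebraMap _ _ z.im * D.θ := by
  simp [ofQuadratic, QuadraticAlgebra.lift, Algebra.smul_def]

lemma σ_smul_ofQuadratic (z : QuadraticAlgebra (𝓞 K) r 0) :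
    D.σ • D.ofQuadratic z = D.ofQuadratic z := by
  simp only [ofQuadratic_apply, smul_add, smul_mul', gal_smul_algebraMap, D.σ_θ]

lemma ofQuadratic_mul_τ_smul (z : QuadraticAlgebra (𝓞 K) r 0) :
    D.ofQuadratic z * D.τ • D.ofQuadratic z = algebraMap _ _ z.norm := by
  simp only [ofQuadratic_apply, smul_add, smul_mul', gal_smul_algebraMap, D.τ_θ,
    QuadraticAlgebra.norm_def, map_add, map_sub, map_mul, ← D.θ_sq, map_zero]
  ring

/-- With `v = (J + iK)(1 - i)ᵃ` one has `v σ(v) = 4ᵃ m`, while `2ᵃ` divides `v + σ(v)` for `a ≤ 2`;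
hence `v / 2ᵃ` is integral, and it is the required element. -/
lemma exists_mul_σ_smul_eq [NumberField L] {J K' m : 𝓞 L} (hJ : D.σ • J = J) (hK : D.σ • K' = K')
    {a : ℕ} (ha : a ≤ 2) (h : J ^ 2 + K' ^ 2 = 2 ^ a * m) : ∃ ρ : 𝓞 L, ρ * D.σ • ρ = m := by
  have hi := D.i_sq
  obtain ⟨v, hv⟩ : ∃ v, v = (J + D.i * K') * (1 - D.i) ^ a := ⟨_, rfl⟩
  have hσv : D.σ • v = (J - D.i * K') * (1 + D.i) ^ a := by
    rw [hv, smul_mul', smul_pow', smul_add, smul_mul', hJ, hK, smul_sub, smul_one, D.σ_i,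
      sub_neg_eq_add, neg_mul, ← sub_eq_add_neg]
  have hmul : v * D.σ • v = (2 ^ a) ^ 2 * m := by
    have hunit : ((1 - D.i) * (1 + D.i)) ^ a = 2 ^ a := by
      congr 1; linear_combination -hi
    have hprod : v * D.σ • v = (J ^ 2 + K' ^ 2) * ((1 - D.i) * (1 + D.i)) ^ a := by
      rw [hσv, hv, mul_pow]
      linear_combination -(1 - D.i) ^ a * (1 + D.i) ^ a * K' ^ 2 * hi
    rw [hprod, hunit, h]
    ring
  obtain ⟨s, hs⟩ : ∃ s, v + D.σ • v = 2 ^ a * s := by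
    rw [hσv, hv]
    interval_cases a
    · exact ⟨2 * J, by ring⟩
    · exact ⟨J + K', by linear_combination -2 * K' * hi⟩
    · exact ⟨K', by linear_combination (2 * J - 4 * K') * hi⟩
  obtain ⟨ρ, rfl⟩ : 2 ^ a ∣ v :=
    dvd_of_sq_sub_mul_add_eq_zero (s := s) (p := m) (by linear_combination v * hs - hmul)
  refine ⟨ρ, mul_left_cancel₀ (pow_ne_zero 2 (pow_ne_zero a two_ne_zero)) (hmul ▸ ?_)⟩
  have hσ2 : D.σ • (2 ^ a : 𝓞 L) = 2 ^ a := by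
    rw [← map_ofNat (algebraMap (𝓞 K) (𝓞 L)) 2, ← map_pow, gal_smul_algebraMap]
  rw [smul_mul', hσ2]
  ring

end BiquadraticData

end Splitting

lemma pos_of_mul_sq_sub_mul_sq_pos {c ε x y : ℝ} (hc : c ≤ 0)
    (h : 0 < ε * (x ^ 2 - c * y ^ 2)) : 0 < ε :=
  pos_of_mul_pos_left h (sub_nonneg.2 ((mul_nonpos_of_nonpos_of_nonneg hc (sq_nonneg y)).trans
    (sq_nonneg x)))

namespace GoldenData

variable {O : Type*} [CommRing O] (d : GoldenData O)

lemma rep_or_exists_eq_sq_sub {l t : O} (hl : Prime l) (hψ : 0 < d.ψ l)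
    (ht : l ∣ t ^ 2 - d.sqrtFive) : d.Rep l ∨ ∃ c e, l = c ^ 2 - d.sqrtFive * e ^ 2 := by
  have hr : d.ψ d.sqrtFive < 0 := by simp [d.ψ_sqrtFive]
  obtain ⟨ε, c, e, hε, rfl⟩ := d.exists_eq_mul_norm
    (fun z hz ↦ eq_zero_of_quadraticNorm_eq_zero d.ψ_injective hr hz) d.reducible_sqrtFive hl ht
  rw [map_mul, map_sub, map_mul, map_pow, map_pow] at hψ
  rcases d.unit_eq_sq_or_neg_w_mul_sq hε (pos_of_mul_sq_sub_mul_sq_pos hr.le hψ) with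
    ⟨η, -, rfl⟩ | ⟨η, -, rfl⟩
  · exact .inr ⟨η * c, η * e, by ring⟩
  · exact .inl ⟨η * c, η * e, by ring⟩

lemma exists_eq_sq_add_sq {l s : O} (hl : Prime l) (hφ : 0 < d.φ l) (hψ : 0 < d.ψ l)
    (hs : l ∣ s ^ 2 + 1) : ∃ x y, l = x ^ 2 + y ^ 2 := by
  obtain ⟨ε, c, e, hε, rfl⟩ := d.exists_eq_mul_norm (D := -1)
    (fun z hz ↦ eq_zero_of_quadraticNorm_eq_zero d.φ_injective (by simp) hz) d.reducible_neg_one hl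
    (s := s) (by rwa [sub_neg_eq_add])
  have hpos (f : O →+* ℝ) (hf : 0 < f (ε * (c ^ 2 - -1 * e ^ 2))) : 0 < f ε := by
    rw [map_mul, map_sub, map_mul, map_pow, map_pow] at hf
    exact pos_of_mul_sq_sub_mul_sq_pos (by simp) hf
  obtain ⟨η, -, rfl⟩ := d.unit_eq_sq hε (hpos _ hφ) (hpos _ hψ)
  exact ⟨η * c, η * e, by ring⟩

end GoldenData

section BiquadraticSplitting

variable {K L : Type*} [Field K] [NumberField K] [Field L] [NumberField L] [Algebra K L]
  [IsGalois K L] {d : GoldenData (𝓞 K)}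

namespace BiquadraticData

lemma exists_intNorm_associated (D : BiquadraticData (-d.sqrtFive) L) {l c e x y : 𝓞 K}
    (hl : Prime l) (h1 : l = c ^ 2 - d.sqrtFive * e ^ 2) (h2 : l = x ^ 2 + y ^ 2) :
    ∃ ρ : 𝓞 L, Associated (Algebra.intNorm (𝓞 K) (𝓞 L) ρ) l := by
  obtain ⟨j, k, m, a, ha, hm, hassoc⟩ := GoldenData.exists_sq_add_sq_eq_two_pow_mul hl h1 h2
  obtain ⟨ρ, hρ⟩ := D.exists_mul_σ_smul_eq (m := D.ofQuadratic m) (D.σ_smul_ofQuadratic j)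
    (D.σ_smul_ofQuadratic k) ha (by
      rw [← map_pow, ← map_pow, ← map_add, hm, map_mul, map_pow, map_ofNat])
  have hN := D.algebraMap_intNorm ρ
  rw [hρ, D.ofQuadratic_mul_τ_smul, (FaithfulSMul.algebraMap_injective (𝓞 K) (𝓞 L)).eq_iff] at hN
  exact ⟨ρ, hN ▸ hassoc⟩

/-- If a prime above `l` had a generator `x`, the norm of `x` would be `l` times the square of a
unit, and `l` would be a square modulo `√5`. -/
lemma not_isPrincipal (D : BiquadraticData d.sqrtFive L) {l : 𝓞 K} (hl : Prime l)
    (hφ : 0 < d.φ l) (hψ : 0 < d.ψ l) (hrep : d.Rep l) (hr : ¬ d.sqrtFive ∣ l) {P : Ideal (𝓞 L)}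
    (hP : P ∈ (Ideal.span {l}).primesOver (𝓞 L)) (hf : P.inertiaDeg (𝓞 K) = 1) :
    ¬ P.IsPrincipal := by
  rintro ⟨x, rfl⟩
  have := isMaximal_span_singleton hl
  have := hP.2
  have := Ideal.isMaximal_of_mem_primesOver hP
  have hrel := Ideal.relNorm_eq_pow_of_isMaximal (Ideal.span {x}) (Ideal.span {l})
  rw [hf, pow_one, Ideal.relNorm_singleton, Ideal.span_singleton_eq_span_singleton] at hrel
  obtain ⟨a, e, hae⟩ := D.exists_four_mul_intNorm_eq d.prime_sqrtFive x
  obtain ⟨ε, hε⟩ := hrel.symm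
  have hpos {f : 𝓞 K →+* ℝ} (hf : Function.Injective f) (hfl : 0 < f l) : 0 < f ε := by
    have hnonneg := D.intNorm_nonneg hf x
    rw [← hε, map_mul] at hnonneg
    exact (nonneg_of_mul_nonneg_right hnonneg hfl).lt_of_ne'
      ((map_ne_zero_iff f hf).2 ε.ne_zero)
  obtain ⟨η, hη, hεη⟩ := d.unit_eq_sq ε.isUnit (hpos d.φ_injective hφ) (hpos d.ψ_injective hψ)
  obtain ⟨η', hη'⟩ := hη.exists_right_inv
  rw [← hε, hεη] at hae
  refine hrep.not_sqrtFive_dvd_sq_sub hr (x := 2 * a * η')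
    ⟨3 * d.sqrtFive * l + 4 * η' ^ 2 * e ^ 2, ?_⟩
  linear_combination -4 * η' ^ 2 * hae + 16 * l * (η * η' + 1) * hη' - 3 * l * d.sqrtFive_sq

lemma rep_of_not_isPrincipal (D : BiquadraticData (-d.sqrtFive) L) {l s t : 𝓞 K} (hl : Prime l)
    (hφ : 0 < d.φ l) (hψ : 0 < d.ψ l) (hs : l ∣ s ^ 2 + 1) (ht : l ∣ t ^ 2 - d.sqrtFive)
    (h : ∀ P ∈ (Ideal.span {l}).primesOver (𝓞 L), ¬ P.IsPrincipal) : d.Rep l := by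
  refine (d.rep_or_exists_eq_sq_sub hl hψ ht).resolve_right ?_
  rintro ⟨c, e, hce⟩
  obtain ⟨x, y, hxy⟩ := d.exists_eq_sq_add_sq hl hφ hψ hs
  obtain ⟨ρ, hρ⟩ := D.exists_intNorm_associated hl hce hxy
  have hprime : (Ideal.span {l}).IsPrime := (Ideal.span_singleton_prime hl.ne_zero).2 hl
  refine h (Ideal.span {ρ}) (mem_primesOver_of_relNorm_eq (by simpa using hl.ne_zero) ?_) ⟨ρ, rfl⟩
  rw [Ideal.relNorm_singleton, Ideal.span_singleton_eq_span_singleton]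
  exact hρ

end BiquadraticData

/-- The condition on the right is `SplitsNonPrincipal` over a general base field. -/
lemma rep_and_conj_rep_iff (D : BiquadraticData d.sqrtFive L) {l : 𝓞 K} (hl : Prime l)
    (hφ : 0 < d.φ l) (hψ : 0 < d.ψ l) (hcop : IsCoprime l (2 * d.sqrtFive)) :
    d.Rep l ∧ d.conj.Rep l ↔
      (∀ P ∈ (Ideal.span {l}).primesOver (𝓞 L),
        P.ramificationIdx (𝓞 K) = 1 ∧ P.inertiaDeg (𝓞 K) = 1) ∧
      ∀ P ∈ (Ideal.span {l}).primesOver (𝓞 L), ¬ P.IsPrincipal := by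
  have h2 : ¬ l ∣ 2 := fun h ↦ hl.not_isUnit (hcop.of_mul_right_left.isUnit_of_dvd h)
  have hlr : ¬ l ∣ d.sqrtFive := fun h ↦ hl.not_isUnit (hcop.of_mul_right_right.isUnit_of_dvd h)
  have hrl : ¬ d.sqrtFive ∣ l := fun h ↦
    d.prime_sqrtFive.not_isUnit (hcop.of_mul_right_right.symm.isUnit_of_dvd h)
  constructor
  · rintro ⟨h, h'⟩
    obtain ⟨s, hs⟩ := GoldenData.Rep.exists_dvd_sq_add_one hl hlr h h'
    obtain ⟨t, ht⟩ := h.exists_dvd_sq_sub hl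
    have hsplit (P) (hP : P ∈ (Ideal.span {l}).primesOver (𝓞 L)) :=
      D.ramificationIdx_eq_one_and_inertiaDeg_eq_one hl h2 hlr hs ht hP
    exact ⟨hsplit, fun P hP ↦ D.not_isPrincipal hl hφ hψ h hrl hP (hsplit P hP).2⟩
  · rintro ⟨hsplit, hnp⟩
    have := isMaximal_span_singleton hl
    obtain ⟨P, hPprime, hPover⟩ :=
      Ideal.exists_maximal_ideal_liesOver_of_isIntegral (S := 𝓞 L) (Ideal.span {l})
    have hP : P ∈ (Ideal.span {l}).primesOver (𝓞 L) := ⟨hPprime.isPrime, hPover⟩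
    obtain ⟨s, hs⟩ := exists_dvd_sq_sub_of_inertiaDeg_eq_one hl hP (hsplit P hP).2
      (c := -1) (by rw [D.i_sq, map_neg, map_one])
    obtain ⟨t, ht⟩ := exists_dvd_sq_sub_of_inertiaDeg_eq_one hl hP (hsplit P hP).2 D.θ_sq
    rw [sub_neg_eq_add] at hs
    have ht' : l ∣ (s * t) ^ 2 - d.conj.sqrtFive := by
      rw [d.conj_sqrtFive]
      convert! (hs.mul_right (t ^ 2)).sub ht using 1
      ring
    have D' : BiquadraticData (-d.conj.sqrtFive) L := by rwa [d.conj_sqrtFive, neg_neg]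
    exact ⟨D.conj.rep_of_not_isPrincipal hl hφ hψ hs ht hnp,
      D'.rep_of_not_isPrincipal hl hψ hφ hs ht' hnp⟩

end BiquadraticSplitting

/-! ### The splitting field of `t⁴ - 5` -/

section SplittingField

open Polynomial

variable {K L : Type*} [Field K] [CharZero K] [Field L] [CharZero L] [Algebra K L]

lemma isGalois_of_isSplittingField [IsSplittingField ℚ L (X ^ 4 - 5)] : IsGalois K L := by
  have : IsGalois ℚ L := by
    refine IsGalois.of_separable_splitting_field (p := (X ^ 4 - 5 : ℚ[X])) ?_
    rw [← map_ofNat C 5]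
    exact separable_X_pow_sub_C _ (by norm_num) (by norm_num)
  exact IsGalois.tower_top_of_isGalois ℚ K L

lemma exists_sq_eq_of_isSplittingField [IsSplittingField ℚ L (X ^ 4 - 5)] {s : L}
    (hs : s ^ 2 = 5) : ∃ i θ : L, i ^ 2 = -1 ∧ θ ^ 2 = s := by
  have hs0 : s ≠ 0 := by
    rintro rfl
    norm_num at hs
  have hmap : (X ^ 4 - 5 : ℚ[X]).map (algebraMap ℚ L) = (X ^ 2 - C s) * (X ^ 2 - C (-s)) := by
    simp only [Polynomial.map_sub, Polynomial.map_pow, map_X, Polynomial.map_ofNat, map_neg]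
    rw [← map_ofNat C 5, ← hs, map_pow]
    ring
  have hsplits := IsSplittingField.splits L (X ^ 4 - 5 : ℚ[X])
  rw [hmap] at hsplits
  have hne : (X ^ 2 - C s) * (X ^ 2 - C (-s)) ≠ 0 :=
    mul_ne_zero (X_pow_sub_C_ne_zero two_pos s) (X_pow_sub_C_ne_zero two_pos (-s))
  have hroot (c : L) (hc : X ^ 2 - C c ∣ (X ^ 2 - C s) * (X ^ 2 - C (-s))) : ∃ y, y ^ 2 = c := by
    obtain ⟨y, hy⟩ := (hsplits.of_dvd hne hc).exists_eval_eq_zero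
      (by rw [degree_X_pow_sub_C two_pos]; norm_num)
    exact ⟨y, by simpa [sub_eq_zero] using hy⟩
  obtain ⟨θ, hθ⟩ := hroot s (dvd_mul_right _ _)
  obtain ⟨y, hy⟩ := hroot (-s) (dvd_mul_left _ _)
  exact ⟨y / θ, θ, by rw [div_pow, hy, hθ, neg_div, div_self hs0], hθ⟩

lemma eq_one_of_isSplittingField [IsSplittingField ℚ L (X ^ 4 - 5)] {i θ : L} (hi : i ^ 2 = -1)
    (hθ : θ ^ 4 = 5) {g : Gal(L/K)} (hgi : g i = i) (hgθ : g θ = θ) : g = 1 := by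
  suffices (g.restrictScalars ℚ : L →ₐ[ℚ] L) = AlgHom.id ℚ L from
    AlgEquiv.ext fun x ↦ DFunLike.congr_fun this x
  refine AlgHom.ext_of_adjoin_eq_top (IsSplittingField.adjoin_rootSet L (X ^ 4 - 5 : ℚ[X]))
    fun x hx ↦ (?_ : g x = x)
  have hx4 : x ^ 4 - 5 = 0 := by simpa [map_ofNat] using aeval_eq_zero_of_mem_rootSet hx
  have hfactor : (x - θ) * (x + θ) * ((x - i * θ) * (x + i * θ)) = 0 := by
    linear_combination hx4 - (θ ^ 2 * x ^ 2 - θ ^ 4) * hi - hθ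
  simp only [mul_eq_zero, sub_eq_zero, add_eq_zero_iff_eq_neg] at hfactor
  rcases hfactor with (rfl | rfl) | (rfl | rfl) <;> simp [hgi, hgθ]

lemma nonempty_biquadraticData_goldenF₀ [Algebra F₀ L] [IsSplittingField ℚ L (X ^ 4 - 5)] :
    Nonempty (BiquadraticData goldenF₀.sqrtFive L) := by
  have := isGalois_of_isSplittingField (K := F₀) (L := L)
  have hs : algebraMap F₀ L sqrt5 ^ 2 = 5 := by rw [← map_pow, sqrt5_sq, map_ofNat]
  obtain ⟨i₀, θ₀, hi₀, hθ₀⟩ := exists_sq_eq_of_isSplittingField hs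
  have hθ₄ : θ₀ ^ 4 = 5 := by rw [← hs, ← hθ₀, ← pow_mul]
  obtain ⟨i, rfl⟩ : ∃ i : 𝓞 L, (i : L) = i₀ :=
    ⟨⟨i₀, .of_pow two_pos (hi₀ ▸ isIntegral_one.neg)⟩, rfl⟩
  obtain ⟨θ, rfl⟩ : ∃ θ : 𝓞 L, (θ : L) = θ₀ :=
    ⟨⟨θ₀, .of_pow two_pos (by
      rw [hθ₀, ← coe_sqrt5Int]
      exact (RingOfIntegers.isIntegral_coe _).algebraMap)⟩, rfl⟩
  refine nonempty_biquadraticData goldenF₀.φ_injective goldenF₀.ψ_injective (i := i) (θ := θ)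
    (by simp [goldenF₀.φ_sqrtFive]) (by simp [goldenF₀.ψ_sqrtFive])
    (RingOfIntegers.coe_injective (by simpa using hi₀)) (RingOfIntegers.coe_injective ?_)
    fun g hgi hgθ ↦ eq_one_of_isSplittingField hi₀ hθ₄ (by rw [← coe_gal_smul, hgi])
      (by rw [← coe_gal_smul, hgθ])
  rw [map_pow, hθ₀, goldenF₀_sqrtFive, ← coe_sqrt5Int]
  rfl

end SplittingField

end QuadRep

end

open QuadRep in
theorem mainTheorem10 (L : Type*) [Field L] [NumberField L] [Algebra F₀ L]
    [Polynomial.IsSplittingField ℚ L (Polynomial.X ^ 4 - 5)]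
    (lam : 𝓞 F₀) (hpos : TotallyPositive lam) (hirr : Irreducible lam) :
    (IsCoprime lam (2 * sqrt5Int) →
      ((Representable lam ∧ RepresentableConj lam) ↔ SplitsNonPrincipal L (Ideal.span {lam}))) ∧
    ((4 : 𝓞 F₀) ∣ lam - (-1) → Representable lam → RepresentableConj lam →
      ∃ x y x' y' : F₀, q x y = lam ∧ qConj x' y' = lam ∧
        ∃ x₁ d₁ x₁' d₁' : 𝓞 F₀,
          (x₁ : F₀) = 2 * x ∧ (d₁ : F₀) = y + u * x ∧
          (x₁' : F₀) = 2 * x' ∧ (d₁' : F₀) = y' + uConj * x' ∧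
          (2 : 𝓞 F₀) ∣ x₁ ∧ (2 : 𝓞 F₀) ∣ d₁ - uInt ∧
          (2 : 𝓞 F₀) ∣ x₁' ∧ (2 : 𝓞 F₀) ∣ d₁' - uConjInt) := by
  have := goldenF₀.isPrincipalIdealRing
  have hl : Prime lam := hirr.prime
  have hφ : 0 < goldenF₀.φ lam := hpos _
  have hψ : 0 < goldenF₀.ψ lam := hpos _
  have := isGalois_of_isSplittingField (K := F₀) (L := L)
  obtain ⟨D⟩ := nonempty_biquadraticData_goldenF₀ (L := L)
  rw [representable_iff hl.ne_zero, representableConj_iff hl.ne_zero, sub_neg_eq_add,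
    q_eq_quadForm, qConj_eq_quadForm, ← coe_uConjInt]
  refine ⟨rep_and_conj_rep_iff D hl hφ hψ, fun h4 hrep hrep' ↦ ?_⟩
  obtain ⟨x, y, hq, x₁, d₁, hx, hd, hx₁, hd₁⟩ := hrep.exists_quadForm_eq h4
  obtain ⟨x', y', hq', x₁', d₁', hx', hd', hx₁', hd₁'⟩ := hrep'.exists_quadForm_eq h4
  exact ⟨x, y, x', y', hq, hq', x₁, d₁, x₁', d₁', hx, hd, hx', hd', hx₁, hd₁, hx₁', hd₁'⟩
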